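/- Let $\mathbb F$ be a finite field with $q$ elements, and let $\mathcal K=\mathbb F((X^{-1}))$ be the field of formal Laurent series in $X^{-1}$ with the absolute value normalized by $|X|=q$, so that $|f|=q^{\deg f}$ for every nonzero polynomial $f\in\mathbb F[X]$. For $n\ge 1$ equip $\mathcal K^n$ with the maximum norm $\|x\|=\max_i|x_i|$ and the distance $\|x-y\|$. For a function $\psi$ on the positive reals, a vector $x\in\mathcal K^n$ with $\|x\|\le 1$ is called $\psi$-approximable if $$\Big\|x-\frac{f}{g}\Big\|\le\psi(|g|)\quad\text{for infinitely many }(f,g)\in\mathbb F[X]^n\times(\mathbb F[X]\setminus\{0\}),$$ and exactly $\psi$-approximable if it is $\psi$-approximable but not $c\psi$-approximable for any $0<c<1$. Let $\operatorname{Exact}(1,n,\psi)$ be the set of exactly $\psi$-approximable vectors. Let $n\ge1$, let $s$ be a real number with $s>1+\frac1n$, and let $\psi_s(r)=r^{-s}$. Then the Hausdorff dimension of this set is $$\dim_H \operatorname{Exact}(1,n,\psi_s)=\frac{n+1}{s}.$$ -/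

import Mathlib

open Polynomial

noncomputable section

namespace FormalSeries

/-- The field `F((X⁻¹))` of formal Laurent series in `X⁻¹` over the field `F`. It is a copy of the
field of Laurent series over `F`, in which the variable of the Laurent series is read as `X⁻¹`:
the element `∑ aₖ X⁻ᵏ` has the coefficient `aₖ` at `k`. -/
def Series (F : Type*) [Field F] : Type _ := LaurentSeries F

variable {F : Type*} [Field F]

instance : Field (Series F) := inferInstanceAs (Field (LaurentSeries F))

/-- The least `k` such that the coefficient of `X⁻ᵏ` is nonzero (and `0` for the zero series). -/
def ord (x : Series F) : ℤ := HahnSeries.order (show HahnSeries ℤ F from x)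

/-- The inclusion of the polynomial ring `F[X]` in `F((X⁻¹))`; it sends `X` to `(X⁻¹)⁻¹`. -/
def ofPoly : F[X] →+* Series F :=
  Polynomial.eval₂RingHom (HahnSeries.C : F →+* HahnSeries ℤ F) (HahnSeries.single (-1 : ℤ) (1 : F))

open Classical in
/-- The absolute value on `F((X⁻¹))`, normalized by `|X| = #F`. -/
def absVal (x : Series F) : ℝ := if x = 0 then 0 else (Nat.card F : ℝ) ^ (-ord x)

theorem absVal_zero : absVal (0 : Series F) = 0 := by simp [absVal]

theorem absVal_of_ne {x : Series F} (hx : x ≠ 0) : absVal x = (Nat.card F : ℝ) ^ (-ord x) := by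
  simp [absVal, hx]

theorem ord_mul {x y : Series F} (hx : x ≠ 0) (hy : y ≠ 0) : ord (x * y) = ord x + ord y :=
  HahnSeries.order_mul (x := (show HahnSeries ℤ F from x)) (y := (show HahnSeries ℤ F from y)) hx hy

theorem ord_neg (x : Series F) : ord (-x) = ord x :=
  HahnSeries.order_neg (f := (show HahnSeries ℤ F from x))

theorem min_ord_le {x y : Series F} (h : x + y ≠ 0) : min (ord x) (ord y) ≤ ord (x + y) :=
  HahnSeries.min_order_le_order_add
    (x := (show HahnSeries ℤ F from x)) (y := (show HahnSeries ℤ F from y)) h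

theorem absVal_neg (x : Series F) : absVal (-x) = absVal x := by
  by_cases hx : x = 0
  · simp [hx]
  · rw [absVal_of_ne hx, absVal_of_ne (neg_ne_zero.2 hx), ord_neg]

theorem absVal_nonneg (x : Series F) : 0 ≤ absVal x := by
  unfold absVal
  split_ifs <;> positivity

section Finite

variable [Finite F]

theorem one_lt_card : (1 : ℝ) < Nat.card F := by
  exact_mod_cast Finite.one_lt_card (α := F)

theorem absVal_eq_zero {x : Series F} (h : absVal x = 0) : x = 0 := by
  by_contra hx
  rw [absVal_of_ne hx] at h
  have h1 := one_lt_card (F := F)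
  exact (zpow_pos (by linarith) _).ne' h

theorem absVal_mul (x y : Series F) : absVal (x * y) = absVal x * absVal y := by
  by_cases hx : x = 0
  · simp [hx, absVal_zero]
  by_cases hy : y = 0
  · simp [hy, absVal_zero]
  have h1 := one_lt_card (F := F)
  rw [absVal_of_ne hx, absVal_of_ne hy, absVal_of_ne (mul_ne_zero hx hy), ord_mul hx hy,
    ← zpow_add₀ (by linarith), neg_add]

theorem absVal_add_le_max (x y : Series F) : absVal (x + y) ≤ max (absVal x) (absVal y) := by
  by_cases hx : x = 0
  · simp [hx]
  by_cases hy : y = 0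
  · simp [hy]
  by_cases hxy : x + y = 0
  · rw [hxy, absVal_zero]
    exact le_max_of_le_left (absVal_nonneg x)
  have h1 := one_lt_card (F := F)
  rw [absVal_of_ne hx, absVal_of_ne hy, absVal_of_ne hxy, le_max_iff]
  rcases min_le_iff.1 (min_ord_le hxy) with h | h
  · exact Or.inl (zpow_le_zpow_right₀ h1.le (neg_le_neg h))
  · exact Or.inr (zpow_le_zpow_right₀ h1.le (neg_le_neg h))

theorem absVal_add_le (x y : Series F) : absVal (x + y) ≤ absVal x + absVal y :=
  (absVal_add_le_max x y).trans
    (max_le_add_of_nonneg (absVal_nonneg x) (absVal_nonneg y))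

/-- `F((X⁻¹))` as a normed field, with norm `absVal` and distance `absVal (x - y)`. -/
instance : NormedField (Series F) where
  toField := inferInstance
  norm := absVal
  dist x y := absVal (x - y)
  dist_self x := by simp [absVal_zero]
  dist_comm x y := by rw [← absVal_neg, neg_sub]
  dist_triangle x y z := by
    have h := absVal_add_le (x - y) (y - z)
    rwa [sub_add_sub_cancel] at h
  eq_of_dist_eq_zero h := sub_eq_zero.1 (absVal_eq_zero h)
  dist_eq x y := by rw [← absVal_neg, neg_sub, sub_eq_neg_add]
  norm_mul := absVal_mul

/-- The `ψ`-approximable vectors in the unit ball of `F((X⁻¹))ⁿ` (with the maximum norm): those `x`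
for which `‖x - f / g‖ ≤ ψ(|g|)` for infinitely many pairs `(f, g)` in `F[X]ⁿ × (F[X] \ {0})`. -/
def Approximable (F : Type*) [Field F] [Finite F] (n : ℕ) (ψ : ℝ → ℝ) : Set (Fin n → Series F) :=
  {x | (∀ i, ‖x i‖ ≤ 1) ∧
    {p : (Fin n → F[X]) × F[X] | p.2 ≠ 0 ∧
      ‖x - fun i => ofPoly (p.1 i) / ofPoly p.2‖ ≤ ψ ‖ofPoly p.2‖}.Infinite}

/-- The exactly `ψ`-approximable vectors: those that are `ψ`-approximable, but not
`cψ`-approximable for any `0 < c < 1`. -/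
def Exact (F : Type*) [Field F] [Finite F] (n : ℕ) (ψ : ℝ → ℝ) : Set (Fin n → Series F) :=
  {x | x ∈ Approximable F n ψ ∧
    ∀ c : ℝ, 0 < c → c < 1 → x ∉ Approximable F n (fun r => c * ψ r)}

end Finite

end FormalSeries

end

/-! Write `q` for the number of elements of `F`.

Upper bound. A solution `f/g` of the approximation inequality lies in the unit ball, so at most
`q^((n+1)(e+1))` pairs matter when `deg g = e`, each with a ball of radius `q^(-s e)`. The covering
sums in dimension `t` converge as soon as `s t > n + 1` (`dimH_approximable_le`).

Lower bound. For `s t < n + 1` one builds a tree of fractions in which the denominators at level `k`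
have a common degree `D k`. A child of `p` is at distance exactly `q^(-⌈s D k⌉)` from `p`, and by
the ultrametric inequality the limit `x` of the branch keeps this distance. Norms of nonzero series
are integer powers of `q`, so exactness is obtained from degrees with `⌈s D k⌉ - s D k → 0`, which
Dirichlet's theorem provides (`frequently_ceil_sub_le`). Moreover no fraction with denominator
degree in `[D k, D (k+1))`, other than multiples of `p`, may approximate a child to the order `ψ`;
then `x` has no better approximations (`mem_exact_of_seq`).

Such children abound (`le_ncard_childSet`). Around `p` of degree `a`, each irreducible `g` of degree
`d` has at least `q^(n(d-⌈s a⌉))` candidate numerators. Competitors with denominator `u` of degree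
`e` are split at `s e = d`. If `s e > d`, invertibility of `u` modulo `g` bounds the numerators
spoilt by `u` (`ncard_irreducible_mul_sub_le`). If `s e ≤ d`, the competitor must be near `p`, and
`Good`, a bound on short vectors of the lattice attached to `p`, limits the number of competitors
(`Good.ncard_le`). Both contributions decay like `q^(-δ e)` with `δ = n(s-1) - 1`, and `δ > 0` is
the hypothesis on `s` (`eventually_children_bound`).

Finally, there are at least `q^((1-ε)d)` monic irreducible denominators for large `d`. The uniform
measure on branches gives a ball of small radius `ρ` mass at most `ρ^t`: for `ρ ≥ q^(-d)` children
are counted denominator by denominator (`card_children_le`), and for smaller `ρ` goodness separates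
them (`card_good_le`). The mass distribution principle (`le_dimH_of_tree`) concludes. -/

noncomputable section

namespace FormalSeries

set_option linter.unusedSectionVars false

/-! ### Coefficients, norms and polynomial parts -/

section

variable {F : Type*} [Field F]

/-- The coefficient of `X⁻ʲ`. -/
def coeff (z : Series F) (j : ℤ) : F := HahnSeries.coeff (show HahnSeries ℤ F from z) j

theorem coeff_sub (x y : Series F) (j : ℤ) : coeff (x - y) j = coeff x j - coeff y j :=
  HahnSeries.coeff_sub (x := (show HahnSeries ℤ F from x)) (y := (show HahnSeries ℤ F from y))

theorem coeff_ofPoly (p : F[X]) (j : ℤ) :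
    coeff (ofPoly p) j = if j ≤ 0 then p.coeff (-j).toNat else 0 := by
  have hX : ∀ n : ℕ, (HahnSeries.single (-1 : ℤ) (1 : F)) ^ n = HahnSeries.single (-(n : ℤ)) 1 := by
    intro n
    rw [HahnSeries.single_pow]
    simp
  have h : (ofPoly p : HahnSeries ℤ F) =
      p.sum fun n a => HahnSeries.single (-(n : ℤ)) a := by
    change Polynomial.eval₂ (HahnSeries.C : F →+* HahnSeries ℤ F) _ p = _
    rw [Polynomial.eval₂_eq_sum]
    refine Finset.sum_congr rfl fun n _ => ?_
    simp only [hX]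
    rw [HahnSeries.C_apply, HahnSeries.single_mul_single]
    simp
  change HahnSeries.coeff (ofPoly p : HahnSeries ℤ F) j = _
  rw [h, Polynomial.sum_def]
  have h2 : HahnSeries.coeff (∑ n ∈ p.support, HahnSeries.single (-(n : ℤ)) (p.coeff n)) j =
      ∑ n ∈ p.support, HahnSeries.coeff (HahnSeries.single (-(n : ℤ)) (p.coeff n)) j :=
    HahnSeries.coeff_sum j
  rw [h2]
  split_ifs with hj
  · rw [Finset.sum_eq_single (-j).toNat]
    · have : -(((-j).toNat : ℕ) : ℤ) = j := by omega
      rw [this, HahnSeries.coeff_single_same]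
    · intro b _ hb
      exact HahnSeries.coeff_single_of_ne (by omega)
    · intro hb
      rw [Polynomial.notMem_support_iff.1 hb]
      simp
  · refine Finset.sum_eq_zero fun n _ => ?_
    exact HahnSeries.coeff_single_of_ne (by omega)

theorem le_ord_iff {z : Series F} (hz : z ≠ 0) (m : ℤ) :
    m ≤ ord z ↔ ∀ j < m, coeff z j = 0 := by
  constructor
  · intro h j hj
    exact HahnSeries.coeff_eq_zero_of_lt_order (lt_of_lt_of_le hj h)
  · intro h
    by_contra! hm
    have h1 : HahnSeries.coeff (show HahnSeries ℤ F from z) (ord z) ≠ 0 :=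
      HahnSeries.coeff_order_eq_zero.not.2 hz
    exact h1 (h _ hm)

theorem exists_sub_coeff_eq_zero (z : Series F) :
    ∃ p : F[X], ∀ j ≤ 0, coeff (z - ofPoly p) j = 0 := by
  refine ⟨∑ i ∈ Finset.range ((-ord z).toNat + 1), Polynomial.monomial i (coeff z (-(i : ℤ))), ?_⟩
  intro j hj
  rw [coeff_sub, coeff_ofPoly, if_pos hj, Polynomial.finsetSum_coeff]
  simp only [Polynomial.coeff_monomial]
  rw [Finset.sum_ite_eq']
  have h : -((-j).toNat : ℤ) = j := by omega
  split_ifs with h1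
  · rw [h, sub_self]
  · rw [sub_zero]
    refine HahnSeries.coeff_eq_zero_of_lt_order ?_
    change j < ord z
    simp only [Finset.mem_range] at h1
    omega

/-- Completeness, read off coefficients: the coefficient at `j` is frozen once `R k > j`. The frozen
values have support bounded below because those below `R 0` already come from `y 0`. -/
theorem exists_limit_coeff (y : ℕ → Series F) (R : ℕ → ℤ) (hR : StrictMono R)
    (h : ∀ k, ∀ j < R k, coeff (y (k + 1) - y k) j = 0) :
    ∃ x : Series F, ∀ k, ∀ j < R k, coeff (x - y k) j = 0 := by
  have hRk : ∀ k : ℕ, R 0 + k ≤ R k := by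
    intro k
    induction k with
    | zero => simp
    | succ k ih =>
      have := hR (Nat.lt_succ_self k)
      push_cast
      simp only [Nat.succ_eq_add_one] at this
      omega
  have h' : ∀ k l, k ≤ l → ∀ j < R k, coeff (y l) j = coeff (y k) j := by
    intro k l hkl
    induction l, hkl using Nat.le_induction with
    | base => intro j _; rfl
    | succ l hkl ih =>
      intro j hj
      have := h l j (hj.trans_le (hR.monotone hkl))
      rw [coeff_sub, sub_eq_zero] at this
      rw [this, ih j hj]
  -- Since `R k ≥ R 0 + k`, the coefficient at `j` is already frozen at this index.
  let c : ℤ → F := fun j => coeff (y (j - R 0 + 1).toNat) j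
  have hc : ∀ k, ∀ j < R k, c j = coeff (y k) j := by
    intro k j hj
    have h1 : j < R (j - R 0 + 1).toNat := by
      have := hRk (j - R 0 + 1).toNat
      omega
    rcases le_total k (j - R 0 + 1).toNat with hk | hk
    · exact h' _ _ hk j hj
    · exact (h' _ _ hk j h1).symm
  have hb : BddBelow (Function.support c) := by
    refine ⟨min (R 0) (ord (y 0)), fun j hj => ?_⟩
    by_contra! hlt
    refine hj ?_
    rw [hc 0 j (hlt.trans_le (min_le_left _ _))]
    exact HahnSeries.coeff_eq_zero_of_lt_order (hlt.trans_le (min_le_right _ _))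
  let x : Series F := (HahnSeries.ofSuppBddBelow c hb : HahnSeries ℤ F)
  refine ⟨x, fun k j hj => ?_⟩
  rw [coeff_sub, sub_eq_zero, ← hc k j hj]
  rfl

theorem card_degreeLT (k : ℕ) : Nat.card (Polynomial.degreeLT F k) = Nat.card F ^ k := by
  rw [Nat.card_congr (Polynomial.degreeLTEquiv F k).toEquiv, Nat.card_fun, Nat.card_fin]

variable [Finite F]

variable (F) in
/-- The number of elements of `F`, as a real number. -/
abbrev Q : ℝ := (Nat.card F : ℝ)

theorem Q_pos : 0 < Q F := zero_lt_one.trans one_lt_card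

theorem Q_two_le : 2 ≤ Q F := by
  have : 2 ≤ Nat.card F := Finite.one_lt_card (α := F)
  exact_mod_cast this

instance : IsUltrametricDist (Series F) where
  dist_triangle_max x y z := by
    have h := absVal_add_le_max (x - y) (y - z)
    rwa [sub_add_sub_cancel] at h

theorem norm_eq {z : Series F} (hz : z ≠ 0) : ‖z‖ = Q F ^ (-ord z) := absVal_of_ne hz

theorem norm_le_zpow_iff (z : Series F) (m : ℤ) :
    ‖z‖ ≤ Q F ^ (-m) ↔ ∀ j < m, coeff z j = 0 := by
  by_cases hz : z = 0
  · subst hz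
    simp only [norm_zero]
    exact ⟨fun _ j _ => rfl, fun _ => (zpow_pos Q_pos _).le⟩
  · rw [norm_eq hz, zpow_le_zpow_iff_right₀ one_lt_card, neg_le_neg_iff, le_ord_iff hz]

theorem norm_lt_zpow_iff (z : Series F) (m : ℤ) :
    ‖z‖ < Q F ^ m ↔ ‖z‖ ≤ Q F ^ (m - 1) := by
  by_cases hz : z = 0
  · subst hz
    simp [zpow_pos (Q_pos (F := F)), (zpow_pos (Q_pos (F := F)) _).le]
  · rw [norm_eq hz, zpow_le_zpow_iff_right₀ one_lt_card, zpow_lt_zpow_iff_right₀ one_lt_card]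
    omega

/-- The nonzero norms are integer powers of `q`, so real exponents can be rounded down. -/
theorem norm_le_rpow_iff (z : Series F) (y : ℝ) :
    ‖z‖ ≤ Q F ^ y ↔ ‖z‖ ≤ Q F ^ ⌊y⌋ := by
  by_cases hz : z = 0
  · subst hz
    simp [(zpow_pos (Q_pos (F := F)) _).le, (Real.rpow_pos_of_pos (Q_pos (F := F)) _).le]
  · rw [norm_eq hz, ← Real.rpow_intCast, ← Real.rpow_intCast,
      Real.rpow_le_rpow_left_iff one_lt_card, Real.rpow_le_rpow_left_iff one_lt_card,
      ← Int.le_floor, Int.cast_le]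

theorem norm_ofPoly {p : F[X]} (hp : p ≠ 0) : ‖ofPoly p‖ = Q F ^ (p.natDegree : ℤ) := by
  apply le_antisymm
  · rw [← neg_neg (p.natDegree : ℤ), norm_le_zpow_iff]
    intro j hj
    rw [coeff_ofPoly]
    split_ifs with h
    · exact Polynomial.coeff_eq_zero_of_natDegree_lt (by omega)
    · rfl
  · by_contra! h
    rw [norm_lt_zpow_iff, ← neg_neg ((p.natDegree : ℤ) - 1), norm_le_zpow_iff] at h
    have := h (-(p.natDegree : ℤ)) (by omega)
    rw [coeff_ofPoly, if_pos (by omega)] at this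
    simp [hp] at this

theorem norm_ofPoly_lt_iff (p : F[X]) (k : ℕ) :
    ‖ofPoly p‖ < Q F ^ (k : ℤ) ↔ p ∈ Polynomial.degreeLT F k := by
  by_cases hp : p = 0
  · subst hp
    simp [pow_pos (Q_pos (F := F))]
  · rw [norm_ofPoly hp, zpow_lt_zpow_iff_right₀ one_lt_card, Polynomial.mem_degreeLT,
      Polynomial.degree_eq_natDegree hp]
    norm_cast

theorem norm_ofPoly_le_iff (p : F[X]) (k : ℕ) :
    ‖ofPoly p‖ ≤ Q F ^ (k : ℤ) ↔ p ∈ Polynomial.degreeLT F (k + 1) := by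
  rw [← norm_ofPoly_lt_iff, norm_lt_zpow_iff]
  simp

theorem eq_zero_of_norm_ofPoly_lt_one {p : F[X]} (h : ‖ofPoly p‖ < 1) : p = 0 := by
  by_contra hp
  rw [norm_ofPoly hp] at h
  exact absurd h (not_lt.2 (by simpa using one_le_pow₀ (one_lt_card (F := F)).le))

theorem ofPoly_ne_zero {p : F[X]} (hp : p ≠ 0) : ofPoly p ≠ 0 := by
  rw [← norm_pos_iff, norm_ofPoly hp]
  exact zpow_pos Q_pos _

theorem exists_norm_sub_ofPoly_lt_one (z : Series F) : ∃ p : F[X], ‖z - ofPoly p‖ < 1 := by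
  obtain ⟨p, hp⟩ := exists_sub_coeff_eq_zero z
  refine ⟨p, ?_⟩
  rw [← zpow_zero (Q F), norm_lt_zpow_iff, zero_sub, norm_le_zpow_iff]
  exact fun j hj => hp j (by omega)

theorem exists_limit {n : ℕ} (y : ℕ → Fin n → Series F) (R : ℕ → ℤ) (hR : StrictMono R)
    (h : ∀ k, ‖y (k + 1) - y k‖ ≤ Q F ^ (-R k)) :
    ∃ x : Fin n → Series F, ∀ k, ‖x - y k‖ ≤ Q F ^ (-R k) := by
  have hpos : ∀ k, 0 ≤ Q F ^ (-R k) := fun k => (zpow_pos Q_pos _).le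
  have h1 : ∀ i, ∃ x : Series F, ∀ k, ∀ j < R k, coeff (x - y k i) j = 0 := by
    intro i
    refine exists_limit_coeff (fun k => y k i) R hR fun k => ?_
    rw [← norm_le_zpow_iff]
    exact (pi_norm_le_iff_of_nonneg (hpos k)).1 (h k) i
  choose x hx using h1
  refine ⟨x, fun k => (pi_norm_le_iff_of_nonneg (hpos k)).2 fun i => ?_⟩
  exact (norm_le_zpow_iff _ _).2 (hx i k)

instance (k : ℕ) : Finite (Polynomial.degreeLT F k) :=
  Finite.of_equiv _ (Polynomial.degreeLTEquiv F k).toEquiv.symm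

end

/-! ### Hausdorff dimension of trees in ultrametric spaces -/

section

open MeasureTheory Filter Topology NNReal ENNReal in
/-- The mass distribution principle for balls in an ultrametric space. -/
theorem le_dimH_of_measure_closedBall_le {X Ω : Type*} [MetricSpace X] [IsUltrametricDist X]
    [TopologicalSpace Ω] [MeasurableSpace Ω] [OpensMeasurableSpace Ω]
    (P : Measure Ω) [IsProbabilityMeasure P] (Φ : Ω → X) (hΦ : Continuous Φ) (E : Set X)
    (hE : ∀ ω, Φ ω ∈ E) (t : ℝ≥0) (ρ₀ : ℝ) (hρ₀ : 0 < ρ₀)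
    (h : ∀ ω₀ ρ, 0 < ρ → ρ < ρ₀ →
      P {ω | dist (Φ ω) (Φ ω₀) ≤ ρ} ≤ ENNReal.ofReal (ρ ^ (t : ℝ))) :
    (t : ℝ≥0∞) ≤ dimH E := by
  borelize X
  have hμ : P.map Φ ≤ μH[(t : ℝ)] := by
    refine Measure.le_hausdorffMeasure _ _ (ENNReal.ofReal (ρ₀ / 2))
      (ENNReal.ofReal_pos.2 (half_pos hρ₀)) fun s hs => ?_
    have hfin : Metric.ediam s ≠ ∞ := ne_top_of_le_ne_top ENNReal.ofReal_ne_top hs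
    rcases s.eq_empty_or_nonempty with rfl | ⟨x, hx⟩
    · simp
    set δ := (Metric.ediam s).toReal with hδ
    have hδ0 : 0 ≤ δ := ENNReal.toReal_nonneg
    have hδs : Metric.ediam s = ENNReal.ofReal δ := (ENNReal.ofReal_toReal hfin).symm
    have hδρ : δ < ρ₀ := by
      have : δ ≤ ρ₀ / 2 := by
        rw [hδs, ENNReal.ofReal_le_ofReal_iff (half_pos hρ₀).le] at hs
        exact hs
      linarith
    have hsub : s ⊆ Metric.closedBall x δ := by
      intro y hy
      have h1 := Metric.edist_le_ediam_of_mem hy hx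
      rw [hδs, edist_dist, ENNReal.ofReal_le_ofReal_iff hδ0] at h1
      exact h1
    -- The diameter `δ` may be `0` while `h` needs positive radii: the bound is proved for `ρ`
    -- slightly above `δ`, and then `ρ → δ`. Any point of an ultrametric ball is a centre, so the
    -- ball can be recentred at a point of the image of `Φ`.
    have hle : ∀ ρ, δ ≤ ρ → 0 < ρ → ρ < ρ₀ → P.map Φ s ≤ ENNReal.ofReal (ρ ^ (t : ℝ)) := by
      intro ρ h1 h2 h3
      have h4 : P.map Φ s ≤ P (Φ ⁻¹' Metric.closedBall x ρ) := by
        rw [← Measure.map_apply hΦ.measurable Metric.isClosed_closedBall.measurableSet]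
        exact measure_mono (hsub.trans (Metric.closedBall_subset_closedBall h1))
      refine h4.trans ?_
      rcases (Φ ⁻¹' Metric.closedBall x ρ).eq_empty_or_nonempty with h5 | ⟨ω₀, hω₀⟩
      · simp [h5]
      · rw [IsUltrametricDist.closedBall_eq_of_mem hω₀]
        exact h ω₀ ρ h2 h3
    rw [hδs, ENNReal.ofReal_rpow_of_nonneg hδ0 t.coe_nonneg]
    have hlim : Tendsto (fun ρ : ℝ => ENNReal.ofReal (ρ ^ (t : ℝ))) (𝓝[>] δ)
        (𝓝 (ENNReal.ofReal (δ ^ (t : ℝ)))) := by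
      refine ENNReal.tendsto_ofReal (Tendsto.mono_left ?_ nhdsWithin_le_nhds)
      exact (Real.continuousAt_rpow_const _ _ (Or.inr t.coe_nonneg)).tendsto
    refine ge_of_tendsto hlim ?_
    have hev : ∀ᶠ ρ in 𝓝[>] δ, ρ < ρ₀ :=
      eventually_nhdsWithin_of_eventually_nhds (eventually_lt_nhds hδρ)
    filter_upwards [hev, self_mem_nhdsWithin] with ρ h1 h2
    exact hle ρ (le_of_lt h2) (hδ0.trans_lt h2) h1
  refine le_dimH_of_hausdorffMeasure_ne_zero (ne_of_gt ?_)
  calc (0 : ℝ≥0∞) < 1 := zero_lt_one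
    _ = P (Φ ⁻¹' E) := by
      rw [Set.eq_univ_of_forall (s := Φ ⁻¹' E) hE, measure_univ]
    _ ≤ P.map Φ E := Measure.le_map_apply hΦ.measurable.aemeasurable E
    _ ≤ _ := hμ E

/-- The vertex of a tree that is reached from the root `p₀` by the first `k` choices in `ω`. -/
def branch {𝒩 : Type*} {N : ℕ → ℕ} (c : ∀ k, 𝒩 → Fin (N k) → 𝒩) (p₀ : 𝒩)
    (ω : ∀ k, Fin (N k)) : ℕ → 𝒩
  | 0 => p₀
  | k + 1 => c k (branch c p₀ ω k) (ω k)

theorem branch_congr {𝒩 : Type*} {N : ℕ → ℕ} (c : ∀ k, 𝒩 → Fin (N k) → 𝒩) (p₀ : 𝒩)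
    {ω ω' : ∀ k, Fin (N k)} {k : ℕ} (h : ∀ i < k, ω i = ω' i) :
    branch c p₀ ω k = branch c p₀ ω' k := by
  induction k with
  | zero => rfl
  | succ k ih =>
    rw [branch, branch, ih fun i hi => h i (hi.trans (Nat.lt_succ_self k)),
      h k (Nat.lt_succ_self k)]

open MeasureTheory Filter Topology NNReal ENNReal in
/-- A lower bound for the dimension of a set that contains the limits of all branches of a tree. -/
theorem le_dimH_of_tree {X 𝒩 : Type*} [MetricSpace X] [IsUltrametricDist X]
    (pos : 𝒩 → X) (G : ℕ → 𝒩 → Prop) (N : ℕ → ℕ) (c : ∀ k, 𝒩 → Fin (N k) → 𝒩) (p₀ : 𝒩)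
    (r : ℕ → ℝ) (t : ℝ≥0) (E : Set X)
    (hp₀ : G 0 p₀) (hN : ∀ k, 0 < N k) (hG : ∀ k p, G k p → ∀ j, G (k + 1) (c k p j))
    (hr : StrictAnti r) (hr0 : Tendsto r atTop (𝓝 0))
    (hsep : ∀ k p, G k p → ∀ i j, dist (pos (c k p i)) (pos (c k p j)) ≤ r (k + 1) → i = j)
    (hcount : ∀ k, 1 ≤ k → ∀ p, G k p → ∀ i ρ, r (k + 1) ≤ ρ → ρ < r k →
      (Nat.card {j // dist (pos (c k p j)) (pos (c k p i)) ≤ ρ} : ℝ) ≤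
        ρ ^ (t : ℝ) * ∏ i ∈ Finset.range (k + 1), (N i : ℝ))
    (Φ : (∀ k, Fin (N k)) → X) (hΦ : ∀ ω k, dist (Φ ω) (pos (branch c p₀ ω k)) ≤ r k)
    (hE : ∀ ω, Φ ω ∈ E) :
    (t : ℝ≥0∞) ≤ dimH E := by
  have : ∀ k, NeZero (N k) := fun k => ⟨(hN k).ne'⟩
  have hrpos : ∀ k, 0 < r k := fun k =>
    lt_of_le_of_lt (hr.antitone.le_of_tendsto hr0 (k + 1)) (hr (Nat.lt_succ_self k))
  have hbG : ∀ ω k, G k (branch c p₀ ω k) := by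
    intro ω k
    induction k with
    | zero => exact hp₀
    | succ k ih => exact hG k _ ih _
  -- At a first disagreement `i < k`, two siblings would be within `r (i + 1)` of each other,
  -- against `hsep`.
  have hagree : ∀ ω ω' k, dist (Φ ω) (Φ ω') ≤ r k → ∀ i < k, ω i = ω' i := by
    intro ω ω' k hd i
    induction i using Nat.strong_induction_on with
    | _ i ih =>
      intro hi
      have hb : branch c p₀ ω i = branch c p₀ ω' i :=
        branch_congr c p₀ fun j hj => ih j hj (hj.trans hi)
      refine hsep i _ (hbG ω i) _ _ ?_
      have e1 : c i (branch c p₀ ω i) (ω i) = branch c p₀ ω (i + 1) := rfl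
      have e2 : c i (branch c p₀ ω i) (ω' i) = branch c p₀ ω' (i + 1) := by rw [hb]; rfl
      rw [e1, e2]
      refine (dist_triangle_max _ (Φ ω) _).trans (max_le ?_ ?_)
      · rw [dist_comm]; exact hΦ ω (i + 1)
      · refine (dist_triangle_max _ (Φ ω') _).trans (max_le ?_ (hΦ ω' (i + 1)))
        exact hd.trans (hr.antitone hi)
  have hcont : Continuous Φ := by
    rw [continuous_iff_continuousAt]
    intro ω₀
    rw [ContinuousAt, Metric.tendsto_nhds]
    intro ε hε
    obtain ⟨k, hk⟩ := (hr0.eventually (gt_mem_nhds hε)).exists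
    have hopen : {ω : ∀ k, Fin (N k) | ∀ i ∈ Finset.range k, ω i = ω₀ i} ∈ 𝓝 ω₀ := by
      have h1 : ∀ i ∈ Finset.range k, ∀ᶠ ω in 𝓝 ω₀, ω i = ω₀ i := by
        intro i _
        have h2 : ({ω₀ i} : Set (Fin (N i))) ∈ 𝓝 (ω₀ i) := IsOpen.mem_nhds (isOpen_discrete _) rfl
        exact (continuous_apply i).continuousAt h2
      exact (Filter.eventually_all_finset _).2 h1
    filter_upwards [hopen] with ω hω
    have hb : branch c p₀ ω k = branch c p₀ ω₀ k :=
      branch_congr c p₀ fun i hi => hω i (Finset.mem_range.2 hi)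
    refine lt_of_le_of_lt ((dist_triangle_max _ (pos (branch c p₀ ω k)) _).trans
      (max_le (hΦ ω k) ?_)) hk
    rw [hb, dist_comm]
    exact hΦ ω₀ k
  let u : ∀ k, Measure (Fin (N k)) := fun k => ProbabilityTheory.uniformOn Set.univ
  have hu : ∀ k, IsProbabilityMeasure (u k) := fun k => by infer_instance
  have huS : ∀ k (S : Set (Fin (N k))), u k S = (Nat.card S : ℝ≥0∞) / N k := by
    intro k S
    simp only [u, ProbabilityTheory.uniformOn_univ, Fintype.card_fin]
    rw [Measure.count_apply_finite S (Set.toFinite S), Nat.card_coe_set_eq,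
      Set.ncard_eq_toFinset_card S]
  refine le_dimH_of_measure_closedBall_le (Measure.infinitePi u) Φ hcont E hE t (r 1)
    (hrpos 1) fun ω₀ ρ hρ0 hρ1 => ?_
  obtain ⟨k, hk1, hk2, hk3⟩ : ∃ k, 1 ≤ k ∧ r (k + 1) ≤ ρ ∧ ρ < r k := by
    have hex : ∃ m, r m ≤ ρ := ((hr0.eventually (ge_mem_nhds hρ0))).exists
    classical
    have h1 := Nat.find_spec hex
    have h2 : 1 < Nat.find hex := by
      by_contra! h
      exact absurd (hr.antitone h) (not_le.2 (h1.trans_lt hρ1))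
    obtain ⟨k, hk⟩ : ∃ k, Nat.find hex = k + 1 := ⟨Nat.find hex - 1, by omega⟩
    refine ⟨k, by omega, hk ▸ h1, not_le.1 (Nat.find_min hex (by omega))⟩
  set p := branch c p₀ ω₀ k with hp
  let A : Set (Fin (N k)) := {j | dist (pos (c k p j)) (pos (c k p (ω₀ k))) ≤ ρ}
  -- The cylinder that fixes the first `k` choices and leaves, for the next one, only the children
  -- within `ρ` of the child chosen by `ω₀`.
  let T : ∀ i, Set (Fin (N i)) := Function.update (fun i => {ω₀ i}) k A
  have hsub : {ω | dist (Φ ω) (Φ ω₀) ≤ ρ} ⊆ Set.pi (Finset.range (k + 1)) T := by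
    intro ω hω i hi
    have hag := hagree ω ω₀ k (le_trans hω hk3.le)
    simp only [Finset.coe_range, Set.mem_Iio] at hi
    rcases Nat.lt_succ_iff_lt_or_eq.1 hi with hi | rfl
    · simp only [T, Function.update_of_ne hi.ne]
      exact hag i hi
    · simp only [T, Function.update_self]
      have hb : branch c p₀ ω i = p := branch_congr c p₀ hag
      have e1 : c i p (ω i) = branch c p₀ ω (i + 1) := by rw [← hb]; rfl
      have e2 : c i p (ω₀ i) = branch c p₀ ω₀ (i + 1) := rfl
      change dist (pos (c i p (ω i))) (pos (c i p (ω₀ i))) ≤ ρ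
      rw [e1, e2]
      refine (dist_triangle_max _ (Φ ω) _).trans (max_le ?_ ?_)
      · rw [dist_comm]; exact (hΦ ω (i + 1)).trans hk2
      · exact (dist_triangle_max _ (Φ ω₀) _).trans
          (max_le hω ((hΦ ω₀ (i + 1)).trans hk2))
  refine (measure_mono hsub).trans ?_
  rw [Measure.infinitePi_pi u fun i _ => (Set.toFinite _).measurableSet, Finset.prod_range_succ]
  have h1 : ∏ i ∈ Finset.range k, u i (T i) = ∏ i ∈ Finset.range k, (1 / (N i : ℝ≥0∞)) := by
    refine Finset.prod_congr rfl fun i hi => ?_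
    rw [huS]
    simp only [T, Function.update_of_ne (Finset.mem_range.1 hi).ne]
    simp
  have h2 : u k (T k) = (Nat.card A : ℝ≥0∞) / N k := by
    rw [huS]
    simp only [T, Function.update_self]
  rw [h1, h2]
  have hc := hcount k hk1 p (hbG ω₀ k) (ω₀ k) ρ hk2 hk3
  have hNpos : ∀ i, (0 : ℝ) < N i := fun i => by exact_mod_cast hN i
  have h3 : ∀ (a b : ℕ), 0 < b → (a : ℝ≥0∞) / b = ENNReal.ofReal ((a : ℝ) / b) := by
    intro a b hb
    rw [ENNReal.ofReal_div_of_pos (by exact_mod_cast hb), ENNReal.ofReal_natCast,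
      ENNReal.ofReal_natCast]
  rw [h3 _ _ (hN k)]
  have h4 : ∏ i ∈ Finset.range k, (1 / (N i : ℝ≥0∞)) =
      ENNReal.ofReal (∏ i ∈ Finset.range k, (1 / (N i : ℝ))) := by
    rw [ENNReal.ofReal_prod_of_nonneg fun i _ => (div_pos one_pos (hNpos i)).le]
    refine Finset.prod_congr rfl fun i _ => ?_
    simpa using h3 1 (N i) (hN i)
  rw [h4, ← ENNReal.ofReal_mul (Finset.prod_nonneg fun i _ => (div_pos one_pos (hNpos i)).le)]
  refine ENNReal.ofReal_le_ofReal ?_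
  have h5 : ∏ i ∈ Finset.range k, (1 / (N i : ℝ)) = 1 / ∏ i ∈ Finset.range k, (N i : ℝ) := by
    simp
  have h6 : 0 < ∏ i ∈ Finset.range k, (N i : ℝ) := Finset.prod_pos fun i _ => hNpos i
  rw [Finset.prod_range_succ] at hc
  rw [h5, div_mul_div_comm, one_mul, div_le_iff₀ (mul_pos h6 (hNpos k))]
  exact hc

end

/-! ### Fractions and the upper bound -/

section

variable {F : Type*} [Field F] [Finite F] {n : ℕ}

/-- The point `f / g` of `F((X⁻¹))ⁿ`. -/
def pt (p : (Fin n → F[X]) × F[X]) : Fin n → Series F := fun i => ofPoly (p.1 i) / ofPoly p.2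

/-- The vector `f - u x`. -/
def defect (x : Fin n → Series F) (p : (Fin n → F[X]) × F[X]) : Fin n → Series F :=
  fun i => ofPoly (p.1 i) - ofPoly p.2 * x i

theorem norm_defect (x : Fin n → Series F) {p : (Fin n → F[X]) × F[X]} (hp : p.2 ≠ 0) :
    ‖defect x p‖ = ‖ofPoly p.2‖ * ‖pt p - x‖ := by
  have h : defect x p = ofPoly p.2 • (pt p - x) := by
    funext i
    have := ofPoly_ne_zero hp
    simp only [defect, pt, Pi.smul_apply, Pi.sub_apply, smul_eq_mul]
    field_simp
  rw [h, norm_smul]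

theorem norm_defect_le_iff (x : Fin n → Series F) {p : (Fin n → F[X]) × F[X]} (hp : p.2 ≠ 0)
    (y : ℝ) : ‖defect x p‖ ≤ Q F ^ (y + p.2.natDegree) ↔ ‖pt p - x‖ ≤ Q F ^ y := by
  rw [norm_defect x hp, norm_ofPoly hp, Real.rpow_add Q_pos, mul_comm (Q F ^ y), zpow_natCast,
    Real.rpow_natCast, mul_le_mul_iff_right₀ (pow_pos Q_pos _)]

theorem norm_vec_le_rpow_iff (z : Fin n → Series F) (y : ℝ) :
    ‖z‖ ≤ Q F ^ y ↔ ‖z‖ ≤ Q F ^ ⌊y⌋ := by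
  rw [pi_norm_le_iff_of_nonneg (Real.rpow_pos_of_pos Q_pos _).le,
    pi_norm_le_iff_of_nonneg (zpow_pos Q_pos _).le]
  exact forall_congr' fun i => norm_le_rpow_iff _ _

theorem norm_div_le_one_iff {f g : F[X]} (hg : g ≠ 0) :
    ‖ofPoly f / ofPoly g‖ ≤ 1 ↔ f ∈ Polynomial.degreeLT F (g.natDegree + 1) := by
  rw [norm_div, div_le_one (norm_pos_iff.2 (ofPoly_ne_zero hg)), norm_ofPoly hg,
    norm_ofPoly_le_iff]

theorem one_le_norm_ofPoly {g : F[X]} (hg : g ≠ 0) : 1 ≤ ‖ofPoly g‖ := by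
  rw [norm_ofPoly hg, zpow_natCast]
  exact one_le_pow₀ one_lt_card.le

theorem rpow_norm_ofPoly {g : F[X]} (hg : g ≠ 0) (s : ℝ) :
    ‖ofPoly g‖ ^ s = Q F ^ (s * g.natDegree) := by
  rw [norm_ofPoly hg, zpow_natCast, ← Real.rpow_natCast, ← Real.rpow_mul Q_pos.le, mul_comm]

variable (F n) in
/-- The pairs `(f, g)` in which all polynomials have degree at most `e`. -/
abbrev PairLE (e : ℕ) : Type _ :=
  (Fin n → Polynomial.degreeLT F (e + 1)) × Polynomial.degreeLT F (e + 1)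

theorem card_pairLE (e : ℕ) : (Nat.card (PairLE F n e) : ℝ) = Q F ^ (((n : ℝ) + 1) * (e + 1)) := by
  rw [Nat.card_prod, Nat.card_fun, card_degreeLT, Nat.card_fin, ← pow_mul, ← pow_add]
  push_cast
  rw [← Real.rpow_natCast]
  congr 1
  push_cast
  ring

theorem exists_pairLE_of_norm_sub_le {x : Fin n → Series F} (hx : ∀ i, ‖x i‖ ≤ 1)
    {p : (Fin n → F[X]) × F[X]} (hp : p.2 ≠ 0) (hxp : ‖x - pt p‖ ≤ 1) {e : ℕ}
    (he : p.2.natDegree ≤ e) : ∃ a : PairLE F n e, ((fun i => (a.1 i : F[X])), (a.2 : F[X])) = p := by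
  have h1 : ∀ i, p.1 i ∈ Polynomial.degreeLT F (e + 1) := by
    intro i
    have h2 : ‖pt p i‖ ≤ 1 := by
      have h3 : ‖x i - pt p i‖ ≤ 1 := (norm_le_pi_norm (x - pt p) i).trans hxp
      have h4 := dist_triangle_max (pt p i) (x i) 0
      rw [dist_zero_right, dist_zero_right, dist_comm, dist_eq_norm] at h4
      exact h4.trans (max_le h3 (hx i))
    exact Polynomial.degreeLT_mono (by omega) ((norm_div_le_one_iff hp).1 h2)
  have h2 : p.2 ∈ Polynomial.degreeLT F (e + 1) := by
    rw [Polynomial.mem_degreeLT, Polynomial.degree_eq_natDegree hp]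
    exact_mod_cast Nat.lt_succ_of_le he
  exact ⟨(fun i => ⟨p.1 i, h1 i⟩, ⟨p.2, h2⟩), rfl⟩

theorem rpow_neg_norm_ofPoly_le_one {g : F[X]} (hg : g ≠ 0) {s : ℝ} (hs : 0 ≤ s) :
    ‖ofPoly g‖ ^ (-s) ≤ 1 :=
  Real.rpow_le_one_of_one_le_of_nonpos (one_le_norm_ofPoly hg) (by linarith)

/-- This turns infinitely many solutions into solutions whose denominators have arbitrarily large
degree. -/
theorem finite_setOf_natDegree_lt {x : Fin n → Series F} (hx : ∀ i, ‖x i‖ ≤ 1) (K : ℕ) :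
    {p : (Fin n → F[X]) × F[X] | p.2 ≠ 0 ∧ ‖x - pt p‖ ≤ 1 ∧ p.2.natDegree < K}.Finite := by
  refine (Set.finite_range fun a : PairLE F n K =>
    ((fun i => (a.1 i : F[X])), (a.2 : F[X]))).subset ?_
  rintro p ⟨h1, h2, h3⟩
  exact exists_pairLE_of_norm_sub_le hx h1 h2 h3.le

open MeasureTheory Filter Topology NNReal ENNReal in
theorem dimH_approximable_le (n : ℕ) (s : ℝ) (hs : 0 < s) :
    dimH (Approximable F n fun r : ℝ => r ^ (-s)) ≤ ENNReal.ofReal ((n + 1) / s) := by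
  borelize (Fin n → Series F)
  have key : ∀ t : ℝ≥0, ((n : ℝ) + 1) / s < t →
      dimH (Approximable F n fun r : ℝ => r ^ (-s)) ≤ t := by
    intro t ht
    rw [div_lt_iff₀ hs] at ht
    set θ : ℝ := Q F ^ ((n : ℝ) + 1 - s * t) with hθ
    have hθ0 : 0 < θ := Real.rpow_pos_of_pos Q_pos _
    have hθ1 : θ < 1 := Real.rpow_lt_one_of_one_lt_of_neg one_lt_card (by linarith)
    set C : ℝ≥0∞ := ENNReal.ofReal (Q F ^ ((n : ℝ) + 1)) * ∑' e : ℕ, ENNReal.ofReal (θ ^ e) with hC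
    have hCfin : C ≠ ∞ := by
      refine ENNReal.mul_ne_top ENNReal.ofReal_ne_top ?_
      exact (summable_geometric_of_lt_one hθ0.le hθ1).tsum_ofReal_ne_top
    refine dimH_le_of_hausdorffMeasure_ne_top (ne_top_of_le_ne_top hCfin ?_)
    -- The index `e` records a denominator of degree `K + e`. Pairs of smaller degree, or with
    -- denominator `0`, only add superfluous balls; the total stays below a constant independent of
    -- `K`.
    let ι : ℕ → Type _ := fun K => Σ e : ℕ, PairLE F n (K + e)
    let B : ∀ K, ι K → Set (Fin n → Series F) := fun K a =>
      Metric.closedBall (pt ((fun i => (a.2.1 i : F[X])), (a.2.2 : F[X])))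
        (Q F ^ (-s * ((K + a.1 : ℕ) : ℝ)))
    have hdiam : ∀ K (a : ι K), Metric.ediam (B K a) ≤
        ENNReal.ofReal (Q F ^ (-s * ((K + a.1 : ℕ) : ℝ))) := by
      intro K a
      refine Metric.ediam_le fun x hx y hy => ?_
      rw [edist_dist]
      refine ENNReal.ofReal_le_ofReal ((dist_triangle_max _ _ _).trans (max_le hx ?_))
      rw [dist_comm]
      exact hy
    have hlim : Tendsto (fun K : ℕ => ENNReal.ofReal (Q F ^ (-s * (K : ℝ)))) atTop (𝓝 0) := by
      rw [← ENNReal.ofReal_zero]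
      refine ENNReal.tendsto_ofReal ?_
      have h1 : Q F ^ (-s) < 1 := Real.rpow_lt_one_of_one_lt_of_neg one_lt_card (by linarith)
      have h2 := tendsto_pow_atTop_nhds_zero_of_lt_one (Real.rpow_pos_of_pos Q_pos _).le h1
      refine h2.congr fun K => ?_
      rw [Real.rpow_mul Q_pos.le, Real.rpow_natCast]
    refine (Measure.hausdorffMeasure_le_liminf_tsum (t : ℝ) _ _ hlim B
      (Eventually.of_forall fun K a => (hdiam K a).trans (ENNReal.ofReal_le_ofReal ?_))
      (Eventually.of_forall fun K x hx => ?_)).trans ?_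
    · refine Real.rpow_le_rpow_of_exponent_le one_lt_card.le ?_
      push_cast
      nlinarith [(Nat.cast_nonneg a.1 : (0 : ℝ) ≤ a.1)]
    · obtain ⟨hx1, hx2⟩ := hx
      obtain ⟨p, hp, hpK⟩ := hx2.exists_notMem_finite (finite_setOf_natDegree_lt hx1 K)
      obtain ⟨hp1, hp2⟩ := hp
      have hle : ‖x - pt p‖ ≤ 1 := le_trans hp2 (rpow_neg_norm_ofPoly_le_one hp1 hs.le)
      have hKp : K ≤ p.2.natDegree := by
        by_contra! h
        exact hpK ⟨hp1, hle, h⟩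
      obtain ⟨e, he⟩ := Nat.exists_eq_add_of_le hKp
      obtain ⟨a, ha⟩ := exists_pairLE_of_norm_sub_le hx1 hp1 hle he.le
      refine Set.mem_iUnion.2 ⟨⟨e, a⟩, ?_⟩
      simp only [B, ha]
      rw [Metric.mem_closedBall, dist_eq_norm, ← he, ← rpow_norm_ofPoly hp1]
      exact hp2
    · have hbound : ∀ K, ∑' a : ι K, Metric.ediam (B K a) ^ (t : ℝ) ≤ C := by
        intro K
        rw [ENNReal.tsum_sigma', hC, ← ENNReal.tsum_mul_left]
        refine ENNReal.tsum_le_tsum fun e => ?_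
        have h1 : ∀ a : PairLE F n (K + e), Metric.ediam (B K ⟨e, a⟩) ^ (t : ℝ) ≤
            ENNReal.ofReal (Q F ^ (-s * t * ((K + e : ℕ) : ℝ))) := by
          intro a
          refine (ENNReal.rpow_le_rpow (hdiam K ⟨e, a⟩) t.coe_nonneg).trans ?_
          rw [ENNReal.ofReal_rpow_of_nonneg (Real.rpow_pos_of_pos Q_pos _).le t.coe_nonneg,
            ← Real.rpow_mul Q_pos.le]
          refine ENNReal.ofReal_le_ofReal (le_of_eq ?_)
          congr 1
          ring
        refine (ENNReal.tsum_le_tsum h1).trans ?_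
        have := Fintype.ofFinite (PairLE F n (K + e))
        rw [tsum_fintype, Finset.sum_const, Finset.card_univ, ← Nat.card_eq_fintype_card,
          nsmul_eq_mul, ← ENNReal.ofReal_natCast, card_pairLE, ← ENNReal.ofReal_mul
            (Real.rpow_pos_of_pos Q_pos _).le, ← ENNReal.ofReal_mul
            (Real.rpow_pos_of_pos Q_pos _).le]
        refine ENNReal.ofReal_le_ofReal ?_
        rw [hθ, ← Real.rpow_natCast, ← Real.rpow_mul Q_pos.le, ← Real.rpow_add Q_pos,
          ← Real.rpow_add Q_pos]
        refine Real.rpow_le_rpow_of_exponent_le one_lt_card.le ?_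
        push_cast
        nlinarith [(Nat.cast_nonneg K : (0 : ℝ) ≤ K)]
      exact (liminf_le_liminf (Eventually.of_forall hbound)).trans (liminf_const C).le
  refine ENNReal.le_of_forall_pos_le_add fun ε hε _ => ?_
  have h0 : 0 ≤ ((n : ℝ) + 1) / s := by positivity
  refine (key (Real.toNNReal (((n : ℝ) + 1) / s) + ε) ?_).trans (le_of_eq ?_)
  · rw [NNReal.coe_add, Real.coe_toNNReal _ h0]
    have : (0 : ℝ) < ε := hε
    linarith
  · rw [ENNReal.coe_add]
    rfl

end

/-! ### Good pairs and counting -/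

section

variable {F : Type*} [Field F] [Finite F] {n : ℕ}

theorem defect_sub (x : Fin n → Series F) (a b : (Fin n → F[X]) × F[X]) :
    defect x (a - b) = defect x a - defect x b := by
  funext i
  simp only [defect, Prod.fst_sub, Prod.snd_sub, Pi.sub_apply, map_sub]
  ring

theorem defect_smul (x : Fin n → Series F) (h : F[X]) (a : (Fin n → F[X]) × F[X]) :
    defect x (h • a) = ofPoly h • defect x a := by
  funext i
  simp only [defect, Prod.smul_fst, Prod.smul_snd, Pi.smul_apply, smul_eq_mul, map_mul]
  ring

theorem defect_self {p : (Fin n → F[X]) × F[X]} (hp : p.2 ≠ 0) : defect (pt p) p = 0 := by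
  funext i
  have := ofPoly_ne_zero hp
  simp only [defect, pt, Pi.zero_apply]
  field_simp
  ring

/-- Without the denominator the defect is a polynomial vector, and nonzero polynomials have norm at
least `1`. -/
theorem eq_zero_of_norm_defect_lt_one {x : Fin n → Series F} {a : (Fin n → F[X]) × F[X]}
    (h2 : a.2 = 0) (h : ‖defect x a‖ < 1) : a = 0 := by
  refine Prod.ext (funext fun i => ?_) h2
  refine eq_zero_of_norm_ofPoly_lt_one (lt_of_le_of_lt ?_ h)
  have := norm_le_pi_norm (defect x a) i
  simpa only [defect, h2, map_zero, zero_mul, sub_zero] using this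

/-- The pair `p = (f, g)` has a monic `g` of degree `d`, and `u f / g` is at a distance greater
than `q ^ (-M)` from `F[X]ⁿ` for all nonzero `u` of degree less than `d`. -/
structure Good (d M : ℕ) (p : (Fin n → F[X]) × F[X]) : Prop where
  monic : p.2.Monic
  natDegree_eq : p.2.natDegree = d
  eq_zero : ∀ a : (Fin n → F[X]) × F[X], a.2 ∈ Polynomial.degreeLT F d →
    ‖defect (pt p) a‖ ≤ Q F ^ (-(M : ℤ)) → a.2 = 0

theorem zpow_neg_lt_one {M : ℕ} (hM : 1 ≤ M) : Q F ^ (-(M : ℤ)) < 1 :=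
  zpow_lt_one_of_neg₀ one_lt_card (by omega)

theorem Good.ne_zero {d M : ℕ} {p : (Fin n → F[X]) × F[X]} (hp : Good d M p) : p.2 ≠ 0 :=
  hp.monic.ne_zero

theorem Good.eq_zero_of_norm_le {d M : ℕ} {p : (Fin n → F[X]) × F[X]} (hp : Good d M p)
    (hM : 1 ≤ M) {a : (Fin n → F[X]) × F[X]} (ha : a.2 ∈ Polynomial.degreeLT F d)
    (h : ‖defect (pt p) a‖ ≤ Q F ^ (-(M : ℤ))) : a = 0 :=
  eq_zero_of_norm_defect_lt_one (hp.eq_zero a ha h) (h.trans_lt (zpow_neg_lt_one hM))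

theorem Good.modByMonic_mem {d M : ℕ} {p : (Fin n → F[X]) × F[X]} (hp : Good d M p) (u : F[X]) :
    u %ₘ p.2 ∈ Polynomial.degreeLT F d := by
  rw [Polynomial.mem_degreeLT, ← hp.natDegree_eq, ← Polynomial.degree_eq_natDegree hp.ne_zero]
  exact Polynomial.degree_modByMonic_lt u hp.monic

/-- Division with remainder by `p.2`: subtracting a multiple of `p` does not change the defect, and
goodness forces the remaining pair, whose denominator has degree below `d`, to vanish. -/
theorem Good.exists_eq_smul {d M : ℕ} {p : (Fin n → F[X]) × F[X]} (hp : Good d M p)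
    (hM : 1 ≤ M) {a : (Fin n → F[X]) × F[X]} (h : ‖defect (pt p) a‖ ≤ Q F ^ (-(M : ℤ))) :
    ∃ u : F[X], a = u • p := by
  refine ⟨a.2 /ₘ p.2, sub_eq_zero.1 (hp.eq_zero_of_norm_le hM ?_ ?_)⟩
  · have := Polynomial.modByMonic_add_div a.2 p.2
    rw [Prod.snd_sub, Prod.smul_snd, smul_eq_mul, mul_comm, ← eq_sub_of_add_eq this]
    exact hp.modByMonic_mem _
  · rwa [defect_sub, defect_smul, defect_self hp.ne_zero, smul_zero, sub_zero]

/-- A pair in `S` is determined by the quotient of its denominator by `p.2` and by the `m` digits of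
each coordinate of the defect at the indices from `M - m` to `M - 1`: two pairs with the same data
differ by a pair that goodness forces to be zero. -/
theorem Good.ncard_le {d M : ℕ} {p : (Fin n → F[X]) × F[X]} (hp : Good d M p) (hM : 1 ≤ M)
    (k m : ℕ) :
    let S := {a : (Fin n → F[X]) × F[X] | a.2 ∈ Polynomial.degreeLT F (d + k) ∧
      ‖defect (pt p) a‖ ≤ Q F ^ ((m : ℤ) - M)}
    S.Finite ∧ S.ncard ≤ Nat.card F ^ k * (Nat.card F ^ m) ^ n := by
  intro S
  have hdiv : ∀ a : S, a.1.2 /ₘ p.2 ∈ Polynomial.degreeLT F k := by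
    intro a
    have ha := a.2.1
    by_cases h0 : a.1.2 /ₘ p.2 = 0
    · rw [h0]; exact Submodule.zero_mem _
    · have ha0 : a.1.2 ≠ 0 := by
        rintro h
        exact h0 (by rw [h, Polynomial.zero_divByMonic])
      rw [Polynomial.mem_degreeLT, Polynomial.degree_eq_natDegree ha0] at ha
      rw [Polynomial.mem_degreeLT, Polynomial.degree_eq_natDegree h0,
        Polynomial.natDegree_divByMonic _ hp.monic, hp.natDegree_eq]
      have ha' : a.1.2.natDegree < d + k := by exact_mod_cast ha
      have h1 : d ≤ a.1.2.natDegree := by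
        by_contra! h
        refine h0 ((Polynomial.divByMonic_eq_zero_iff hp.monic).2 ?_)
        rw [Polynomial.degree_eq_natDegree ha0, Polynomial.degree_eq_natDegree hp.ne_zero,
          hp.natDegree_eq]
        exact_mod_cast h
      have : a.1.2.natDegree - d < k := by omega
      exact_mod_cast this
  let φ : S → Polynomial.degreeLT F k × (Fin n → Fin m → F) := fun a =>
    (⟨_, hdiv a⟩, fun i j => coeff (defect (pt p) a.1 i) ((M : ℤ) - m + j))
  have hφ : Function.Injective φ := by
    intro a b hab
    refine Subtype.ext (sub_eq_zero.1 (hp.eq_zero_of_norm_le hM ?_ ?_))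
    · have h1 : a.1.2 /ₘ p.2 = b.1.2 /ₘ p.2 := congrArg Subtype.val (congrArg Prod.fst hab)
      have h2 := Polynomial.modByMonic_add_div a.1.2 p.2
      have h3 := Polynomial.modByMonic_add_div b.1.2 p.2
      have h4 : (a.1 - b.1).2 = a.1.2 %ₘ p.2 - b.1.2 %ₘ p.2 := by
        rw [Prod.snd_sub]
        linear_combination -h2 + h3 + p.2 * h1
      rw [h4]
      exact Submodule.sub_mem _ (hp.modByMonic_mem _) (hp.modByMonic_mem _)
    · rw [defect_sub, pi_norm_le_iff_of_nonneg (zpow_pos Q_pos _).le]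
      intro i
      rw [Pi.sub_apply, norm_le_zpow_iff]
      intro j hj
      rw [coeff_sub, sub_eq_zero]
      have hz : ∀ c : S, j < (M : ℤ) - m → coeff (defect (pt p) c.1 i) j = 0 := by
        intro c hc
        have h1 := (norm_le_pi_norm (defect (pt p) c.1) i).trans c.2.2
        rw [show (m : ℤ) - M = -((M : ℤ) - m) by ring, norm_le_zpow_iff] at h1
        exact h1 j hc
      by_cases hjm : j < (M : ℤ) - m
      · rw [hz a hjm, hz b hjm]
      · have h1 := congrFun (congrFun (congrArg Prod.snd hab) i)
          ⟨(j - ((M : ℤ) - m)).toNat, by omega⟩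
        simp only [φ] at h1
        have h2 : (M : ℤ) - m + ((j - ((M : ℤ) - m)).toNat : ℕ) = j := by omega
        rwa [h2] at h1
  have : Finite S := Finite.of_injective φ hφ
  refine ⟨Set.toFinite S, ?_⟩
  rw [← Nat.card_coe_set_eq]
  refine (Nat.card_le_card_of_injective φ hφ).trans (le_of_eq ?_)
  rw [Nat.card_prod, card_degreeLT, Nat.card_fun, Nat.card_fun, Nat.card_fin, Nat.card_fin]

theorem Good.ncard_le_rpow {d M : ℕ} {p : (Fin n → F[X]) × F[X]} (hp : Good d M p) (hM : 1 ≤ M)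
    (k : ℕ) (y : ℝ) (hy : -(M : ℝ) ≤ y) :
    let S := {a : (Fin n → F[X]) × F[X] | a.2 ∈ Polynomial.degreeLT F (d + k) ∧
      ‖defect (pt p) a‖ ≤ Q F ^ y}
    S.Finite ∧ (S.ncard : ℝ) ≤ Q F ^ (k + n * (M + y)) := by
  intro S
  have h1 : -(M : ℤ) ≤ ⌊y⌋ := Int.le_floor.2 (by exact_mod_cast hy)
  obtain ⟨m, hm⟩ : ∃ m : ℕ, ⌊y⌋ = (m : ℤ) - M := ⟨(⌊y⌋ + M).toNat, by omega⟩
  have h2 := hp.ncard_le hM k m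
  simp only [← hm, ← norm_vec_le_rpow_iff] at h2
  refine ⟨h2.1, (Nat.cast_le.2 h2.2).trans ?_⟩
  rw [← pow_mul, ← pow_add]
  push_cast
  rw [← Real.rpow_natCast]
  refine Real.rpow_le_rpow_of_exponent_le one_lt_card.le ?_
  have h3 : (m : ℝ) - M ≤ y := by
    have := Int.floor_le y
    rw [hm] at this
    exact_mod_cast this
  push_cast
  nlinarith [(Nat.cast_nonneg n : (0 : ℝ) ≤ n)]

/-- The number of polynomial vectors in a ball is at most the expected one. -/
theorem ncard_norm_sub_le (z : Fin n → Series F) (y : ℝ) (hy : -1 ≤ y) :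
    let S := {f : Fin n → F[X] | ‖(fun i => ofPoly (f i)) - z‖ ≤ Q F ^ y}
    S.Finite ∧ (S.ncard : ℝ) ≤ Q F ^ (n * (y + 1)) := by
  intro S
  have h1 : -1 ≤ ⌊y⌋ := Int.le_floor.2 (by exact_mod_cast hy)
  obtain ⟨k, hk⟩ : ∃ k : ℕ, ⌊y⌋ = (k : ℤ) - 1 := ⟨(⌊y⌋ + 1).toNat, by omega⟩
  rcases S.eq_empty_or_nonempty with h | ⟨f₀, hf₀⟩
  · rw [h]
    exact ⟨Set.finite_empty, by simpa using (Real.rpow_pos_of_pos (Q_pos (F := F)) _).le⟩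
  have hmem : ∀ f : S, ∀ i, f.1 i - f₀ i ∈ Polynomial.degreeLT F k := by
    intro f i
    rw [← norm_ofPoly_lt_iff, norm_lt_zpow_iff, ← hk, ← norm_le_rpow_iff, map_sub]
    have h2 := dist_triangle_max (fun i => ofPoly (f.1 i)) z (fun i => ofPoly (f₀ i))
    rw [dist_comm z, dist_eq_norm, dist_eq_norm, dist_eq_norm] at h2
    exact (norm_le_pi_norm ((fun i => ofPoly (f.1 i)) - fun i => ofPoly (f₀ i)) i).trans
      (h2.trans (max_le f.2 hf₀))
  let φ : S → (Fin n → Polynomial.degreeLT F k) := fun f i => ⟨_, hmem f i⟩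
  have hφ : Function.Injective φ := by
    intro f f' hff
    refine Subtype.ext (funext fun i => ?_)
    exact sub_left_injective (congrArg Subtype.val (congrFun hff i))
  have : Finite S := Finite.of_injective φ hφ
  refine ⟨Set.toFinite S, ?_⟩
  rw [← Nat.card_coe_set_eq]
  refine (Nat.cast_le.2 (Nat.card_le_card_of_injective φ hφ)).trans ?_
  rw [Nat.card_fun, card_degreeLT, Nat.card_fin, ← pow_mul]
  push_cast
  rw [← Real.rpow_natCast]
  refine Real.rpow_le_rpow_of_exponent_le one_lt_card.le ?_
  have h3 : (k : ℝ) - 1 ≤ y := by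
    have := Int.floor_le y
    rw [hk] at this
    exact_mod_cast this
  push_cast
  nlinarith [(Nat.cast_nonneg n : (0 : ℝ) ≤ n)]

/-- To the polynomial part of `z` any vector of polynomials of degree less than `k` can be added. -/
theorem le_ncard_norm_sub_lt (z : Fin n → Series F) (k : ℕ) :
    let S := {f : Fin n → F[X] | ‖(fun i => ofPoly (f i)) - z‖ < Q F ^ k}
    S.Finite ∧ Nat.card F ^ (k * n) ≤ S.ncard := by
  intro S
  have hS : S.Finite := by
    refine (ncard_norm_sub_le z k (by linarith [(Nat.cast_nonneg k : (0 : ℝ) ≤ k)])).1.subset ?_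
    intro f hf
    simp only [Set.mem_ofPred_eq, Real.rpow_natCast]
    exact le_of_lt hf
  refine ⟨hS, ?_⟩
  choose f₀ hf₀ using fun i => exists_norm_sub_ofPoly_lt_one (z i)
  have hpos : (0 : ℝ) < Q F ^ k := pow_pos Q_pos _
  have hmem : ∀ h : Fin n → Polynomial.degreeLT F k, (fun i => f₀ i + (h i : F[X])) ∈ S := by
    intro h
    refine (pi_norm_lt_iff hpos).2 fun i => ?_
    have h1 : ofPoly (f₀ i + (h i : F[X])) - z i =
        ofPoly (h i : F[X]) - (z i - ofPoly (f₀ i)) := by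
      rw [map_add]; ring
    simp only [Pi.sub_apply, h1]
    have h2 := dist_triangle_max (ofPoly (h i : F[X])) 0 (z i - ofPoly (f₀ i))
    rw [dist_zero_right, dist_zero_left, dist_eq_norm] at h2
    refine h2.trans_lt (max_lt ?_ ((hf₀ i).trans_le (one_le_pow₀ one_lt_card.le)))
    rw [← zpow_natCast, norm_ofPoly_lt_iff]
    exact (h i).2
  let φ : (Fin n → Polynomial.degreeLT F k) → S := fun h => ⟨_, hmem h⟩
  have hφ : Function.Injective φ := by
    intro h h' hh
    funext i
    exact Subtype.ext (add_left_cancel (congrFun (congrArg Subtype.val hh) i))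
  have : Finite S := hS
  have := Nat.card_le_card_of_injective φ hφ
  rwa [Nat.card_fun, card_degreeLT, Nat.card_fin, ← pow_mul, Nat.card_coe_set_eq] at this

/-- As `u` is invertible modulo `g` and `W` injects into the residues modulo `g`, a vector `f` is
determined by the residue of `u f`, which has a representative of small degree. Excluding the `f`
divisible by `g` makes the set empty for `y < 0`, where the bound can be less than `1`. -/
theorem ncard_irreducible_mul_sub_le {g u : F[X]} (hg : Irreducible g) (hu : u ≠ 0)
    (hug : u ∈ Polynomial.degreeLT F g.natDegree) {W : Set (Fin n → F[X])}
    (hW : ∀ f ∈ W, ∀ f' ∈ W, ∀ i, f i - f' i ∈ Polynomial.degreeLT F g.natDegree) (y : ℝ) :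
    let S := {f | f ∈ W ∧ (∃ i, ¬ g ∣ f i) ∧
      ∃ f' : Fin n → F[X], ∀ i, ‖ofPoly (u * f i - g * f' i)‖ ≤ Q F ^ y}
    S.Finite ∧ (S.ncard : ℝ) ≤ Q F ^ (n * (y + 1)) := by
  intro S
  have hdvd : ∀ v : F[X], v ∈ Polynomial.degreeLT F g.natDegree → g ∣ v → v = 0 := by
    intro v hv hgv
    rw [Polynomial.mem_degreeLT, ← Polynomial.degree_eq_natDegree hg.ne_zero] at hv
    exact Polynomial.eq_zero_of_dvd_of_degree_lt hgv hv
  have hcop : ∀ v : F[X], g ∣ u * v → g ∣ v := fun v hv =>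
    (hg.prime.dvd_or_dvd hv).resolve_left fun h => hu (hdvd u hug h)
  rcases lt_or_ge ⌊y⌋ 0 with hy | hy
  · have hS : S = ∅ := by
      refine Set.eq_empty_of_forall_notMem ?_
      rintro f ⟨_, ⟨i, hi⟩, f', hf'⟩
      refine hi (hcop _ ⟨f' i, sub_eq_zero.1 (eq_zero_of_norm_ofPoly_lt_one ?_)⟩)
      have := (norm_le_rpow_iff _ _).1 (hf' i)
      exact this.trans_lt (zpow_lt_one_of_neg₀ one_lt_card hy)
    rw [hS]
    exact ⟨Set.finite_empty, by simpa using (Real.rpow_pos_of_pos (Q_pos (F := F)) _).le⟩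
  · obtain ⟨k, hk⟩ := Int.eq_ofNat_of_zero_le hy
    have hex : ∀ f : S, ∃ h : Fin n → Polynomial.degreeLT F (k + 1),
        ∀ i, g ∣ u * f.1 i - h i := by
      rintro ⟨f, _, _, f', hf'⟩
      refine ⟨fun i => ⟨u * f i - g * f' i, ?_⟩, fun i => ?_⟩
      · rw [← norm_ofPoly_le_iff, ← hk, ← norm_le_rpow_iff]
        exact hf' i
      · simp
    choose φ hφ using hex
    have hinj : Function.Injective φ := by
      intro f f' hff
      refine Subtype.ext (funext fun i => sub_eq_zero.1 ?_)
      refine hdvd _ (hW _ f.2.1 _ f'.2.1 i) (hcop _ ?_)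
      have h1 := hφ f i
      rw [hff] at h1
      have h2 := dvd_sub h1 (hφ f' i)
      rwa [sub_sub_sub_cancel_right, ← mul_sub] at h2
    have : Finite S := Finite.of_injective φ hinj
    refine ⟨Set.toFinite S, ?_⟩
    rw [← Nat.card_coe_set_eq]
    refine (Nat.cast_le.2 (Nat.card_le_card_of_injective φ hinj)).trans ?_
    rw [Nat.card_fun, card_degreeLT, Nat.card_fin, ← pow_mul]
    push_cast
    rw [← Real.rpow_natCast]
    refine Real.rpow_le_rpow_of_exponent_le one_lt_card.le ?_
    have h3 : (k : ℝ) ≤ y := by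
      have := Int.floor_le y
      rw [hk] at this
      exact_mod_cast this
    push_cast
    nlinarith [(Nat.cast_nonneg n : (0 : ℝ) ≤ n)]

end

/-! ### The children of a good pair -/

section

variable {F : Type*} [Field F] [Finite F] {n : ℕ}

theorem ncard_biUnion_le_sum {α ι : Type*} (T : Finset ι) (S : ι → Set α) (C : ι → ℝ)
    (h : ∀ t ∈ T, (S t).Finite ∧ ((S t).ncard : ℝ) ≤ C t) :
    (⋃ t ∈ T, S t).Finite ∧ ((⋃ t ∈ T, S t).ncard : ℝ) ≤ ∑ t ∈ T, C t := by
  refine ⟨T.finite_toSet.biUnion fun t ht => (h t ht).1, ?_⟩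
  calc ((⋃ t ∈ T, S t).ncard : ℝ) ≤ ((∑ t ∈ T, (S t).ncard : ℕ) : ℝ) :=
        Nat.cast_le.2 (Finset.set_ncard_biUnion_le T S)
    _ = ∑ t ∈ T, ((S t).ncard : ℝ) := by push_cast; rfl
    _ ≤ _ := Finset.sum_le_sum fun t ht => (h t ht).2

theorem ncard_biUnion_le_mul {α ι : Type*} {T : Set ι} {D : ℝ} (hT : T.Finite ∧ (T.ncard : ℝ) ≤ D)
    (S : ι → Set α) {C : ℝ} (hC : 0 ≤ C)
    (h : ∀ t ∈ T, (S t).Finite ∧ ((S t).ncard : ℝ) ≤ C) :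
    (⋃ t ∈ T, S t).Finite ∧ ((⋃ t ∈ T, S t).ncard : ℝ) ≤ D * C := by
  have h1 := ncard_biUnion_le_sum hT.1.toFinset S (fun _ => C)
    fun t ht => h t (hT.1.mem_toFinset.1 ht)
  simp only [Set.Finite.mem_toFinset, Finset.sum_const, nsmul_eq_mul] at h1
  rw [← Set.ncard_eq_toFinset_card T hT.1] at h1
  exact ⟨h1.1, h1.2.trans (mul_le_mul_of_nonneg_right hT.2 hC)⟩

theorem ncard_union_le_add {α : Type*} {S T : Set α} {C D : ℝ}
    (hS : S.Finite ∧ (S.ncard : ℝ) ≤ C) (hT : T.Finite ∧ (T.ncard : ℝ) ≤ D) :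
    (S ∪ T).Finite ∧ ((S ∪ T).ncard : ℝ) ≤ C + D :=
  ⟨hS.1.union hT.1, (Nat.cast_le.2 (Set.ncard_union_le S T)).trans (by
    push_cast; exact add_le_add hS.2 hT.2)⟩

theorem ncard_le_of_subset {α : Type*} {S V : Set α} {C : ℝ}
    (hV : V.Finite ∧ (V.ncard : ℝ) ≤ C) (hS : S ⊆ V) : S.Finite ∧ (S.ncard : ℝ) ≤ C :=
  ⟨hV.1.subset hS, (Nat.cast_le.2 (Set.ncard_le_ncard hS hV.1)).trans hV.2⟩

theorem ncard_degreeLT_le (k : ℕ) {T : Set F[X]} (hT : ∀ u ∈ T, u ∈ Polynomial.degreeLT F k) :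
    T.Finite ∧ (T.ncard : ℝ) ≤ Q F ^ (k : ℝ) := by
  let φ : T → Polynomial.degreeLT F k := fun u => ⟨u.1, hT u.1 u.2⟩
  have hφ : Function.Injective φ := fun a b h => Subtype.ext (Subtype.mk.inj h)
  have : Finite T := Finite.of_injective φ hφ
  refine ⟨Set.toFinite T, ?_⟩
  have h := Nat.card_le_card_of_injective φ hφ
  rw [card_degreeLT, Nat.card_coe_set_eq] at h
  rw [Real.rpow_natCast]
  exact_mod_cast h

theorem mem_degreeLT_iff_natDegree_lt {u : F[X]} (hu : u ≠ 0) (k : ℕ) :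
    u ∈ Polynomial.degreeLT F k ↔ u.natDegree < k := by
  rw [Polynomial.mem_degreeLT, Polynomial.degree_eq_natDegree hu]
  norm_cast

theorem norm_mul_sub_le_of_norm_defect_le {f : Fin n → F[X]} {g : F[X]} (hg : g ≠ 0)
    (b : (Fin n → F[X]) × F[X]) {y : ℝ} (h : ‖defect (pt (f, g)) b‖ ≤ Q F ^ y) (i : Fin n) :
    ‖ofPoly (b.2 * f i - g * b.1 i)‖ ≤ Q F ^ (g.natDegree + y) := by
  have h0 := ofPoly_ne_zero hg
  have h1 : ofPoly (b.2 * f i - g * b.1 i) = -(ofPoly g * defect (pt (f, g)) b i) := by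
    simp only [defect, pt, map_sub, map_mul]
    field_simp
    ring
  rw [h1, norm_neg, norm_mul, norm_ofPoly hg, Real.rpow_add Q_pos, zpow_natCast,
    Real.rpow_natCast]
  exact mul_le_mul_of_nonneg_left ((norm_le_pi_norm (defect (pt (f, g)) b) i).trans h)
    (pow_pos Q_pos _).le

/-- Few vectors `f` in a small set fail to form a good pair with an irreducible `g`. -/
theorem ncard_not_good_le {g : F[X]} (hg : Irreducible g) (hgm : g.Monic) (M : ℕ)
    {W : Set (Fin n → F[X])}
    (hW : ∀ f ∈ W, ∀ f' ∈ W, ∀ i, f i - f' i ∈ Polynomial.degreeLT F g.natDegree) :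
    let S := {f | f ∈ W ∧ (¬ Good g.natDegree M (f, g) ∨ ∀ i, g ∣ f i)}
    S.Finite ∧ (S.ncard : ℝ) ≤
      1 + Q F ^ (g.natDegree : ℝ) * Q F ^ (n * ((g.natDegree : ℝ) - M + 1)) := by
  intro S
  set d := g.natDegree with hd
  -- At most one vector of `W` is divisible by `g`; it accounts for the summand `1`.
  let S₀ : Set (Fin n → F[X]) := {f | f ∈ W ∧ ∀ i, g ∣ f i}
  have hS₀ : S₀.Subsingleton := by
    intro f hf f' hf'
    funext i
    refine sub_eq_zero.1 (Polynomial.eq_zero_of_dvd_of_degree_lt (dvd_sub (hf.2 i) (hf'.2 i)) ?_)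
    rw [Polynomial.degree_eq_natDegree hg.ne_zero]
    exact Polynomial.mem_degreeLT.1 (hW f hf.1 f' hf'.1 i)
  have h0 : S₀.Finite ∧ (S₀.ncard : ℝ) ≤ 1 :=
    ⟨hS₀.finite, by exact_mod_cast (Set.ncard_le_one hS₀.finite).2 hS₀⟩
  let T : Set F[X] := {u | u ≠ 0 ∧ u ∈ Polynomial.degreeLT F d}
  have hT := ncard_degreeLT_le d (T := T) fun u hu => hu.2
  have h1 := ncard_biUnion_le_mul hT _ (Real.rpow_pos_of_pos (Q_pos (F := F)) _).le
    fun u hu => ncard_irreducible_mul_sub_le hg hu.1 hu.2 hW ((d : ℝ) - M)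
  refine ncard_le_of_subset (ncard_union_le_add h0 h1) ?_
  rintro f ⟨hfW, hf⟩
  by_cases hdvd : ∀ i, g ∣ f i
  · exact Or.inl ⟨hfW, hdvd⟩
  right
  have hng := hf.resolve_right hdvd
  push Not at hdvd
  by_contra hcon
  refine hng ⟨hgm, rfl, fun b hb hbd => ?_⟩
  by_contra hb0
  refine hcon (Set.mem_biUnion (x := b.2) ⟨hb0, hb⟩ ⟨hfW, hdvd, b.1, fun i => ?_⟩)
  rw [sub_eq_add_neg]
  refine norm_mul_sub_le_of_norm_defect_le hg.ne_zero b ?_ i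
  rw [Real.rpow_neg Q_pos.le, Real.rpow_natCast]
  rw [zpow_neg, zpow_natCast] at hbd
  exact hbd

variable (F n) in
/-- The vector with all coordinates `X⁻ᴿ`. -/
def shift (R : ℕ) : Fin n → Series F := fun _ => (ofPoly (Polynomial.X ^ R))⁻¹

theorem norm_shift (hn : 1 ≤ n) (R : ℕ) : ‖shift F n R‖ = Q F ^ (-(R : ℝ)) := by
  have : Nonempty (Fin n) := ⟨⟨0, hn⟩⟩
  have h : ‖(ofPoly (Polynomial.X ^ R : F[X]))⁻¹‖ = Q F ^ (-(R : ℝ)) := by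
    rw [norm_inv, norm_ofPoly (pow_ne_zero _ Polynomial.X_ne_zero), Polynomial.natDegree_X_pow,
      Real.rpow_neg Q_pos.le, zpow_natCast, Real.rpow_natCast]
  exact (pi_norm_const (ι := Fin n) ((ofPoly (Polynomial.X ^ R : F[X]))⁻¹ : Series F)).trans h

/-- The polynomial vectors `f` for which `f / g` is in a given ball of radius less than `q ^ (-R)`
in the sphere of radius `q ^ (-R)` around `f₀ / g₀`, where `p = (f₀, g₀)`. -/
def window (p : (Fin n → F[X]) × F[X]) (R : ℕ) (g : F[X]) : Set (Fin n → F[X]) :=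
  {f | ‖(fun i => ofPoly (f i)) - ofPoly g • (pt p + shift F n R)‖ < Q F ^ (g.natDegree - R)}

/-- The difference of the two points is a perturbation of `shift F n R` by a vector of smaller norm,
which preserves the norm in the ultrametric setting. -/
theorem norm_pt_sub_of_mem_window (hn : 1 ≤ n) {p : (Fin n → F[X]) × F[X]} {R : ℕ} {g : F[X]}
    (hg : g ≠ 0) (hR : R ≤ g.natDegree) {f : Fin n → F[X]} (hf : f ∈ window p R g) :
    ‖pt (f, g) - pt p‖ = Q F ^ (-(R : ℝ)) := by
  have h0 := ofPoly_ne_zero hg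
  have h1 : (fun i => ofPoly (f i)) - ofPoly g • (pt p + shift F n R) =
      ofPoly g • (pt (f, g) - pt p - shift F n R) := by
    funext i
    simp only [pt, Pi.sub_apply, Pi.smul_apply, Pi.add_apply, smul_eq_mul]
    field_simp
    ring
  have h2 : ‖pt (f, g) - pt p - shift F n R‖ < Q F ^ (-(R : ℝ)) := by
    have h3 : ‖(fun i => ofPoly (f i)) - ofPoly g • (pt p + shift F n R)‖ <
      Q F ^ (g.natDegree - R) := hf
    rw [h1, norm_smul, norm_ofPoly hg, zpow_natCast, pow_sub₀ _ Q_pos.ne' hR] at h3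
    rw [Real.rpow_neg Q_pos.le, Real.rpow_natCast]
    exact lt_of_mul_lt_mul_left h3 (pow_pos Q_pos _).le
  rw [← norm_shift hn R] at h2 ⊢
  have h4 := IsUltrametricDist.norm_eq_of_add_norm_lt_max (x := pt (f, g) - pt p)
    (y := -shift F n R) (by
      rw [← sub_eq_add_neg, norm_neg]
      exact h2.trans_le (le_max_right _ _))
  rwa [norm_neg] at h4

theorem sub_mem_degreeLT_of_norm_sub_lt {z : Fin n → Series F} {k d : ℕ} (hk : k ≤ d)
    {f f' : Fin n → F[X]} (hf : ‖(fun i => ofPoly (f i)) - z‖ < Q F ^ k)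
    (hf' : ‖(fun i => ofPoly (f' i)) - z‖ < Q F ^ k) (i : Fin n) :
    f i - f' i ∈ Polynomial.degreeLT F d := by
  refine Polynomial.degreeLT_mono hk ?_
  rw [← norm_ofPoly_lt_iff, map_sub, zpow_natCast]
  have h := dist_triangle_max (fun i => ofPoly (f i)) z (fun i => ofPoly (f' i))
  rw [dist_comm z, dist_eq_norm, dist_eq_norm, dist_eq_norm] at h
  exact (norm_le_pi_norm ((fun i => ofPoly (f i)) - fun i => ofPoly (f' i)) i).trans_lt
    (h.trans_lt (max_lt hf hf'))

/-- Every irreducible polynomial of degree `d` is the denominator of a good pair. -/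
theorem exists_good {g : F[X]} (hg : Irreducible g) (hgm : g.Monic) (M : ℕ)
    (h : 1 + Q F ^ (g.natDegree : ℝ) * Q F ^ (n * ((g.natDegree : ℝ) - M + 1)) <
      Q F ^ ((n : ℝ) * g.natDegree)) :
    ∃ f : Fin n → F[X], Good g.natDegree M (f, g) ∧ ∀ i, ‖pt (f, g) i‖ ≤ 1 := by
  set d := g.natDegree with hd
  let W : Set (Fin n → F[X]) := {f | ‖(fun i => ofPoly (f i)) - 0‖ < Q F ^ d}
  have hW := le_ncard_norm_sub_lt (0 : Fin n → Series F) d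
  have hB := ncard_not_good_le hg hgm M (W := W) fun f hf f' hf' i =>
    sub_mem_degreeLT_of_norm_sub_lt le_rfl hf hf' i
  have hlt : {f | f ∈ W ∧ (¬ Good d M (f, g) ∨ ∀ i, g ∣ f i)}.ncard < W.ncard := by
    have h1 : ((Nat.card F ^ (d * n) : ℕ) : ℝ) = Q F ^ ((n : ℝ) * d) := by
      rw [mul_comm]
      push_cast
      rw [← Real.rpow_natCast]
      push_cast
      ring_nf
    have h2 : (Q F ^ ((n : ℝ) * d) : ℝ) ≤ W.ncard := h1 ▸ Nat.cast_le.2 hW.2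
    exact_mod_cast (hB.2.trans_lt h).trans_le h2
  obtain ⟨f, hf, hfg⟩ := Set.exists_mem_notMem_of_ncard_lt_ncard hlt hB.1
  refine ⟨f, ?_, fun i => ?_⟩
  · by_contra hng
    exact hfg ⟨hf, Or.inl hng⟩
  · have h1 : ‖(fun i => ofPoly (f i)) - (0 : Fin n → Series F)‖ < Q F ^ d := hf
    rw [sub_zero] at h1
    refine (norm_div_le_one_iff hg.ne_zero).2 ((norm_ofPoly_le_iff _ _).1 ?_)
    rw [zpow_natCast]
    exact ((norm_le_pi_norm (fun i => ofPoly (f i)) i).trans_lt h1).le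

/-- The vectors `f` in the window around `p` for which `(f, g)` is good and `f / g` is not close to
any other fraction whose denominator has a degree between those of the denominators of `p` and of
`(f, g)`. -/
def childSet (s : ℝ) (a : ℕ) (p : (Fin n → F[X]) × F[X]) (R M : ℕ) (g : F[X]) :
    Set (Fin n → F[X]) :=
  {f | f ∈ window p R g ∧ Good g.natDegree M (f, g) ∧
    ∀ b : (Fin n → F[X]) × F[X], b.2 ≠ 0 → a ≤ b.2.natDegree → b.2.natDegree < g.natDegree →
      ‖pt b - pt (f, g)‖ ≤ Q F ^ (-(s * b.2.natDegree)) → ∃ u : F[X], b = u • p}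

/-- A union bound over three kinds of bad numerators: those that are divisible by `g` or give no
good pair, those spoilt by a competitor of degree `e` with `s e > d`, and those spoilt by one with
`s e ≤ d`. In the second case the sum runs over denominators only; in the third, over the
competitors near `p`, each of which spoils the numerators in one ball. -/
theorem le_ncard_childSet (hn : 1 ≤ n) {s : ℝ} (hs : 1 ≤ s) {a Ma R M J : ℕ} (hMa : 1 ≤ Ma)
    (hsR : s * a ≤ R) {p : (Fin n → F[X]) × F[X]} (hp : Good a Ma p) {g : F[X]}
    (hg : Irreducible g) (hgm : g.Monic) (hR : R ≤ g.natDegree)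
    (h : (1 + Q F ^ (g.natDegree : ℝ) * Q F ^ (n * ((g.natDegree : ℝ) - M + 1))) +
      (∑ e ∈ (Finset.range g.natDegree).filter (fun e : ℕ => (g.natDegree : ℝ) < s * e),
        Q F ^ ((e + 1 : ℕ) : ℝ) * Q F ^ (n * ((g.natDegree : ℝ) + (e - s * e) + 1))) +
      (∑ e ∈ (Finset.range g.natDegree).filter (fun e : ℕ => a ≤ e ∧ s * e ≤ g.natDegree),
        Q F ^ (((e + 1 - a : ℕ) : ℝ) + n * (Ma + (e - s * a))) *
          Q F ^ (n * ((g.natDegree : ℝ) - s * e + 1))) + J ≤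
      Q F ^ ((n : ℝ) * ((g.natDegree : ℝ) - R))) :
    (childSet s a p R M g).Finite ∧ J ≤ (childSet s a p R M g).ncard := by
  set d := g.natDegree with hd
  have hWd : ∀ f ∈ window p R g, ∀ f' ∈ window p R g, ∀ i, f i - f' i ∈ Polynomial.degreeLT F d :=
    fun f hf f' hf' i => sub_mem_degreeLT_of_norm_sub_lt (Nat.sub_le d R) hf hf' i
  have hW := le_ncard_norm_sub_lt (ofPoly g • (pt p + shift F n R)) (d - R)
  have hB₁ := ncard_not_good_le hg hgm M hWd
  have hB₂ := ncard_biUnion_le_sum ((Finset.range d).filter (fun e : ℕ => (d : ℝ) < s * e)) _ _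
    fun e he => ncard_biUnion_le_mul
      (ncard_degreeLT_le (e + 1) (T := {u : F[X] | u ≠ 0 ∧ u.natDegree = e}) fun u hu =>
        (mem_degreeLT_iff_natDegree_lt hu.1 _).2 (by rw [hu.2]; exact Nat.lt_succ_self e)) _
      (Real.rpow_pos_of_pos (Q_pos (F := F)) _).le
      fun u hu => ncard_irreducible_mul_sub_le hg hu.1 ((mem_degreeLT_iff_natDegree_lt hu.1 _).2
        (by rw [hu.2]; exact Finset.mem_range.1 (Finset.mem_filter.1 he).1)) hWd
        ((d : ℝ) + (e - s * e))
  have hB₃ := ncard_biUnion_le_sum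
    ((Finset.range d).filter (fun e : ℕ => a ≤ e ∧ s * e ≤ d))
    (fun e => ⋃ b ∈ {b : (Fin n → F[X]) × F[X] | b.2 ≠ 0 ∧ b.2.natDegree = e ∧
      ‖defect (pt p) b‖ ≤ Q F ^ ((e : ℝ) - s * a) ∧ ¬ ∃ u : F[X], b = u • p},
      {f : Fin n → F[X] | ‖(fun i => ofPoly (f i)) - ofPoly g • pt b‖ ≤ Q F ^ ((d : ℝ) - s * e)})
    (fun e => Q F ^ (((e + 1 - a : ℕ) : ℝ) + n * (Ma + (e - s * a))) *
          Q F ^ (n * ((d : ℝ) - s * e + 1))) (by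
      intro e he
      obtain ⟨_, he1, he2⟩ := Finset.mem_filter.1 he
      refine ncard_biUnion_le_mul ?_ _ (Real.rpow_pos_of_pos (Q_pos (F := F)) _).le
        fun b _ => ncard_norm_sub_le _ _ (by linarith)
      rcases le_or_gt (-(Ma : ℝ)) ((e : ℝ) - s * a) with hy | hy
      · refine ncard_le_of_subset (hp.ncard_le_rpow hMa (e + 1 - a) _ hy) ?_
        rintro b ⟨hb0, hbe, hb, _⟩
        refine ⟨(mem_degreeLT_iff_natDegree_lt hb0 _).2 (by omega), hb⟩
      -- So close to `p`, goodness leaves only multiples of `p`.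
      · have hempty : {b : (Fin n → F[X]) × F[X] | b.2 ≠ 0 ∧ b.2.natDegree = e ∧
            ‖defect (pt p) b‖ ≤ Q F ^ ((e : ℝ) - s * a) ∧ ¬ ∃ u : F[X], b = u • p} = ∅ := by
          refine Set.eq_empty_of_forall_notMem ?_
          rintro b ⟨_, _, hb, hbu⟩
          refine hbu (hp.exists_eq_smul hMa (hb.trans ?_))
          rw [← Real.rpow_intCast]
          refine Real.rpow_le_rpow_of_exponent_le one_lt_card.le ?_
          push_cast
          exact hy.le
        rw [hempty]
        exact ⟨Set.finite_empty, by simpa using (Real.rpow_pos_of_pos (Q_pos (F := F)) _).le⟩)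
  have hB := ncard_union_le_add (ncard_union_le_add hB₁ hB₂) hB₃
  have hCW : childSet s a p R M g ⊆ window p R g := fun f hf => hf.1
  have hCfin : (childSet s a p R M g).Finite := hW.1.subset hCW
  refine ⟨hCfin, ?_⟩
  have hcover := ncard_le_of_subset (S := window p R g)
    (ncard_union_le_add hB ⟨hCfin, le_refl (((childSet s a p R M g).ncard : ℕ) : ℝ)⟩) ?_
  · have h1 : ((Nat.card F ^ ((d - R) * n) : ℕ) : ℝ) = Q F ^ ((n : ℝ) * ((d : ℝ) - R)) := by
      push_cast
      rw [← Real.rpow_natCast]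
      push_cast [Nat.cast_sub hR]
      ring_nf
    have h2 : (Q F ^ ((n : ℝ) * ((d : ℝ) - R)) : ℝ) ≤ (window p R g).ncard :=
      h1 ▸ Nat.cast_le.2 hW.2
    have h3 := hcover.2
    have h4 : (J : ℝ) ≤ (childSet s a p R M g).ncard := by linarith
    exact_mod_cast h4
  · intro f hf
    by_contra hcon
    simp only [Set.mem_union, not_or] at hcon
    obtain ⟨⟨⟨hc1, hc2⟩, hc3⟩, hc4⟩ := hcon
    have hng : ¬ (¬ Good d M (f, g) ∨ ∀ i, g ∣ f i) := fun h => hc1 ⟨hf, h⟩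
    push Not at hng
    refine hc4 ⟨hf, hng.1, fun b hb0 hab hbd hb => ?_⟩
    by_contra hbu
    set e := b.2.natDegree with he
    have hpt := norm_pt_sub_of_mem_window hn hg.ne_zero hR hf
    rcases lt_or_ge (d : ℝ) (s * e) with hde | hde
    · refine hc2 (Set.mem_biUnion (x := e) (Finset.mem_coe.2 (Finset.mem_filter.2
        ⟨Finset.mem_range.2 hbd, hde⟩)) (Set.mem_biUnion (x := b.2) ⟨hb0, rfl⟩
        ⟨hf, hng.2, b.1, norm_mul_sub_le_of_norm_defect_le hg.ne_zero b ?_⟩))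
      rw [show (e : ℝ) - s * e = -(s * e) + e by ring]
      exact (norm_defect_le_iff _ hb0 _).2 hb
    · refine hc3 (Set.mem_biUnion (x := e) (Finset.mem_coe.2 (Finset.mem_filter.2
        ⟨Finset.mem_range.2 hbd, hab, hde⟩)) (Set.mem_biUnion (x := b)
        ⟨hb0, rfl, ?_, hbu⟩ ?_))
      · rw [show (e : ℝ) - s * a = -(s * a) + e by ring, norm_defect_le_iff _ hb0]
        -- The competitor is within `q^(-s e)` of `f/g`, and `p` is at distance `q^(-R)` from it;
        -- both are at most `q^(-s a)`.
        have h1 := dist_triangle_max (pt b) (pt (f, g)) (pt p)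
        simp only [dist_eq_norm] at h1
        refine h1.trans (max_le (hb.trans ?_) (hpt.le.trans ?_))
        · refine Real.rpow_le_rpow_of_exponent_le one_lt_card.le ?_
          have : (a : ℝ) ≤ e := by exact_mod_cast hab
          nlinarith
        · exact Real.rpow_le_rpow_of_exponent_le one_lt_card.le (by linarith)
      · have h1 : (fun i => ofPoly (f i)) - ofPoly g • pt b = defect (pt b) (f, g) := rfl
        change ‖(fun i => ofPoly (f i)) - ofPoly g • pt b‖ ≤ Q F ^ ((d : ℝ) - s * e)
        rw [h1, show (d : ℝ) - s * e = -(s * e) + d by ring]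
        refine (norm_defect_le_iff (pt b) (p := (f, g)) hg.ne_zero _).2 ?_
        rw [norm_sub_rev]
        exact hb

end

/-! ### Irreducible denominators -/

section

variable {F : Type*} [Field F] [Finite F] {n : ℕ}

variable (F) in
/-- The monic irreducible polynomials of degree `d`. -/
def monicIrreducible (d : ℕ) : Set F[X] := {g | Irreducible g ∧ g.Monic ∧ g.natDegree = d}

theorem finite_monicIrreducible (d : ℕ) : (monicIrreducible F d).Finite :=
  (ncard_degreeLT_le (d + 1) fun _ hg => (mem_degreeLT_iff_natDegree_lt hg.1.ne_zero _).2
    (hg.2.2 ▸ Nat.lt_succ_self _)).1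

/-- Every element of the extension of degree `d` has a minimal polynomial whose degree divides `d`.
This degree is `d` or at most `d / 2`, and each polynomial accounts for at most `d` elements. -/
theorem rpow_le_mul_ncard_monicIrreducible {d : ℕ} (hd : 1 ≤ d) :
    Q F ^ (d : ℝ) ≤ d * ((monicIrreducible F d).ncard + Q F ^ ((d : ℝ) / 2 + 1)) := by
  obtain ⟨p, hp⟩ := CharP.exists F
  have : Fact (Nat.Prime p) := ⟨CharP.char_is_prime F p⟩
  have : NeZero d := ⟨by omega⟩
  let L := FiniteField.Extension F p d
  have hint : ∀ x : L, IsIntegral F x := fun x => Algebra.IsIntegral.isIntegral x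
  have hroots : ∀ m : F[X], m ≠ 0 → m.natDegree ≤ d →
      {x : L | minpoly F x = m}.Finite ∧ (({x : L | minpoly F x = m}.ncard : ℕ) : ℝ) ≤ d := by
    intro m hm hmd
    refine ⟨Set.toFinite _, ?_⟩
    classical
    have hsub : {x : L | minpoly F x = m} ⊆ ((m.map (algebraMap F L)).roots.toFinset : Set L) := by
      rintro x rfl
      rw [Finset.mem_coe, Multiset.mem_toFinset, Polynomial.mem_roots_map hm]
      exact minpoly.aeval F x
    have h1 := Set.ncard_le_ncard hsub (Finset.finite_toSet _)
    rw [Set.ncard_coe_finset] at h1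
    have h2 := (h1.trans (Multiset.toFinset_card_le _)).trans (Polynomial.card_roots' _)
    rw [Polynomial.natDegree_map] at h2
    exact_mod_cast h2.trans hmd
  have hA := ncard_biUnion_le_mul (T := monicIrreducible F d)
    ⟨finite_monicIrreducible d, le_rfl⟩ (fun m => {x : L | minpoly F x = m}) (Nat.cast_nonneg d)
    fun m hm => hroots m hm.1.ne_zero hm.2.2.le
  have hB := ncard_biUnion_le_mul
    (ncard_degreeLT_le (d / 2 + 1) (T := {m : F[X] | m ≠ 0 ∧ m.natDegree ≤ d / 2}) fun m hm =>
      (mem_degreeLT_iff_natDegree_lt hm.1 _).2 (Nat.lt_succ_of_le hm.2))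
    (fun m => {x : L | minpoly F x = m}) (Nat.cast_nonneg d)
    fun m hm => hroots m hm.1 (hm.2.trans (Nat.div_le_self d 2))
  have hall := ncard_le_of_subset (S := (Set.univ : Set L)) (ncard_union_le_add hA hB) (by
    intro x _
    have hdvd := minpoly.degree_dvd (hint x)
    rw [FiniteField.finrank_extension] at hdvd
    rcases (Nat.le_of_dvd (by omega) hdvd).eq_or_lt with h | h
    · exact Or.inl (Set.mem_biUnion (x := minpoly F x)
        ⟨minpoly.irreducible (hint x), minpoly.monic (hint x), h⟩ rfl)
    · refine Or.inr (Set.mem_biUnion (x := minpoly F x) ⟨minpoly.ne_zero (hint x), ?_⟩ rfl)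
      obtain ⟨c, hc⟩ := hdvd
      have hc2 : 2 ≤ c := by
        by_contra! hc1
        interval_cases c <;> omega
      rw [Nat.le_div_iff_mul_le two_pos]
      calc _ ≤ (minpoly F x).natDegree * c := Nat.mul_le_mul_left _ hc2
        _ = d := hc.symm)
  have hcard : ((Set.univ : Set L).ncard : ℝ) = Q F ^ (d : ℝ) := by
    rw [Set.ncard_univ, FiniteField.natCard_extension, Real.rpow_natCast]
    push_cast
    rfl
  rw [hcard] at hall
  have hpow : Q F ^ ((d / 2 + 1 : ℕ) : ℝ) ≤ Q F ^ ((d : ℝ) / 2 + 1) := by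
    refine Real.rpow_le_rpow_of_exponent_le one_lt_card.le ?_
    push_cast
    have : ((d / 2 : ℕ) : ℝ) ≤ (d : ℝ) / 2 := by exact_mod_cast Nat.cast_div_le (α := ℝ)
    linarith
  have hd0 : (0 : ℝ) ≤ d := Nat.cast_nonneg d
  nlinarith [hall.2]

/-- Distinct children of a vertex, if the windows around the vertex have enough elements. -/
theorem exists_children {s : ℝ} {a d R M J : ℕ} {p : (Fin n → F[X]) × F[X]}
    (h : ∀ g ∈ monicIrreducible F d,
      (childSet s a p R M g).Finite ∧ J ≤ (childSet s a p R M g).ncard) :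
    ∃ c : Fin ((monicIrreducible F d).ncard * J) → (Fin n → F[X]) × F[X], Function.Injective c ∧
      ∀ j, (c j).2 ∈ monicIrreducible F d ∧ (c j).1 ∈ childSet s a p R M (c j).2 := by
  have hfin : Finite (monicIrreducible F d) := finite_monicIrreducible d
  have e : Fin (monicIrreducible F d).ncard ≃ monicIrreducible F d := by
    rw [← Nat.card_coe_set_eq]
    exact (Finite.equivFin _).symm
  have hex : ∀ g : monicIrreducible F d,
      ∃ φ : Fin J → (Fin n → F[X]), Function.Injective φ ∧ ∀ j, φ j ∈ childSet s a p R M g := by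
    intro g
    obtain ⟨h1, h2⟩ := h g g.2
    have : Finite (childSet s a p R M g.1) := h1
    have := Fintype.ofFinite (childSet s a p R M g.1)
    have h3 : Fintype.card (Fin J) ≤ Fintype.card (childSet s a p R M g.1) := by
      rwa [Fintype.card_fin, ← Nat.card_eq_fintype_card, Nat.card_coe_set_eq]
    obtain ⟨ψ⟩ := Function.Embedding.nonempty_of_card_le h3
    exact ⟨fun j => (ψ j).1, fun i j hij => ψ.injective (Subtype.ext hij), fun j => (ψ j).2⟩
  choose φ hφ1 hφ2 using hex
  refine ⟨fun j => (φ (e (finProdFinEquiv.symm j).1) (finProdFinEquiv.symm j).2,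
    (e (finProdFinEquiv.symm j).1 : F[X])), ?_, fun j => ⟨(e _).2, hφ2 _ _⟩⟩
  intro i j hij
  have h1 := e.injective (Subtype.ext (congrArg Prod.snd hij))
  have h2 := congrArg Prod.fst hij
  simp only [h1] at h2
  exact finProdFinEquiv.symm.injective (Prod.ext h1 (hφ1 _ h2))

theorem norm_vec_sub_smul_le_iff (x : Fin n → Series F) {f : Fin n → F[X]} {g : F[X]} (hg : g ≠ 0)
    (y : ℝ) : ‖(fun i => ofPoly (f i)) - ofPoly g • x‖ ≤ Q F ^ (y + g.natDegree) ↔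
      ‖pt (f, g) - x‖ ≤ Q F ^ y :=
  norm_defect_le_iff x (p := (f, g)) hg y

/-- The estimate for radii at least `q^(-d)`: after multiplication by each denominator separately,
the ball has radius at least `1` and its polynomial vectors can be counted. -/
theorem card_children_le {ι : Type*} {d : ℕ} {c : ι → (Fin n → F[X]) × F[X]}
    (hc : Function.Injective c) (hd : ∀ j, (c j).2 ∈ monicIrreducible F d) (x : Fin n → Series F)
    {y : ℝ} (hy : -(d : ℝ) ≤ y) :
    (Nat.card {j // ‖pt (c j) - x‖ ≤ Q F ^ y} : ℝ) ≤
      (monicIrreducible F d).ncard * Q F ^ (n * (y + d + 1)) := by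
  have h1 := ncard_biUnion_le_mul (T := monicIrreducible F d)
    ⟨finite_monicIrreducible d, le_rfl⟩
    (fun g => (fun f => ((f, g) : (Fin n → F[X]) × F[X])) ''
      {f : Fin n → F[X] | ‖(fun i => ofPoly (f i)) - ofPoly g • x‖ ≤ Q F ^ (y + d)})
    (Real.rpow_pos_of_pos (Q_pos (F := F)) _).le fun g _ => by
      have h2 := ncard_norm_sub_le (ofPoly g • x) (y + d) (by linarith)
      exact ⟨h2.1.image _, (Nat.cast_le.2 (Set.ncard_image_le h2.1)).trans h2.2⟩
  refine le_trans (Nat.cast_le.2 ?_) h1.2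
  rw [← Nat.card_coe_set_eq]
  have := h1.1.to_subtype
  refine Nat.card_le_card_of_injective (fun j => ⟨c j.1, ?_⟩) fun i j hij =>
    Subtype.ext (hc (Subtype.mk.inj hij))
  refine Set.mem_biUnion (hd j.1) ⟨(c j.1).1, ?_, rfl⟩
  have := (norm_vec_sub_smul_le_iff x (hd j.1).1.ne_zero y).2 j.2
  rwa [(hd j.1).2.2] at this

/-- Goodness of `p` makes `b` a multiple of `p`; monic denominators of equal degree leave only the
factor `1`. -/
theorem Good.eq_of_norm_sub_le {d M : ℕ} (hM : 1 ≤ M) {p b : (Fin n → F[X]) × F[X]}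
    (hp : Good d M p) (hb : Good d M b) {y : ℝ} (hy : y + d ≤ -M)
    (h : ‖pt b - pt p‖ ≤ Q F ^ y) : b = p := by
  rw [← norm_defect_le_iff (pt p) hb.ne_zero, hb.natDegree_eq] at h
  obtain ⟨u, rfl⟩ := hp.exists_eq_smul hM (h.trans (by
    rw [← Real.rpow_intCast]
    refine Real.rpow_le_rpow_of_exponent_le one_lt_card.le ?_
    push_cast
    exact hy))
  have hu : u.Monic := by
    have h1 := hb.monic
    rw [Prod.smul_snd, smul_eq_mul] at h1
    exact Polynomial.Monic.of_mul_monic_right hp.monic h1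
  have h2 := hb.natDegree_eq
  rw [Prod.smul_snd, smul_eq_mul, hu.natDegree_mul hp.monic, hp.natDegree_eq] at h2
  rw [hu.natDegree_eq_zero.1 (by omega), one_smul]

/-- The estimate for small radii, where counting per denominator is too crude: the pairs near `c i`
are counted all at once by the goodness of `c i`, and below its threshold only `c i` itself remains.
-/
theorem card_good_le {ι : Type*} {d M : ℕ} (hM : 1 ≤ M) {c : ι → (Fin n → F[X]) × F[X]}
    (hc : Function.Injective c) (hd : ∀ j, Good d M (c j)) (i : ι) (y : ℝ) :
    (Nat.card {j // ‖pt (c j) - pt (c i)‖ ≤ Q F ^ y} : ℝ) ≤ 1 ∨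
      (Nat.card {j // ‖pt (c j) - pt (c i)‖ ≤ Q F ^ y} : ℝ) ≤ Q F ^ (1 + n * (M + (y + d))) := by
  rcases le_or_gt (-(M : ℝ)) (y + d) with hy | hy
  · right
    have h1 := (hd i).ncard_le_rpow hM 1 (y + d) hy
    rw [Nat.cast_one] at h1
    refine le_trans (Nat.cast_le.2 ?_) h1.2
    rw [← Nat.card_coe_set_eq]
    have := h1.1.to_subtype
    refine Nat.card_le_card_of_injective (fun j => ⟨c j.1, ?_⟩) fun i j hij =>
      Subtype.ext (hc (Subtype.mk.inj hij))
    refine ⟨(mem_degreeLT_iff_natDegree_lt (hd j.1).ne_zero _).2 ?_, ?_⟩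
    · rw [(hd j.1).natDegree_eq]
      exact Nat.lt_succ_self d
    · have := (norm_defect_le_iff (pt (c i)) (hd j.1).ne_zero y).2 j.2
      rwa [(hd j.1).natDegree_eq] at this
  · left
    have hs : Subsingleton {j // ‖pt (c j) - pt (c i)‖ ≤ Q F ^ y} := by
      refine ⟨fun j k => Subtype.ext (hc ?_)⟩
      rw [(hd i).eq_of_norm_sub_le hM (hd j.1) hy.le j.2,
        (hd i).eq_of_norm_sub_le hM (hd k.1) hy.le k.2]
    exact_mod_cast Finite.card_le_one_iff_subsingleton.2 hs

end

/-! ### Asymptotic inequalities -/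

section

open Filter Topology

theorem eventually_le_mul_natCast (C : ℝ) {η : ℝ} (hη : 0 < η) : ∀ᶠ d : ℕ in atTop, C ≤ η * d :=
  (tendsto_natCast_atTop_atTop.const_mul_atTop hη).eventually_ge_atTop C

theorem eventually_natCast_mul_rpow_le {q : ℝ} (hq : 1 < q) (C : ℝ) {η c : ℝ} (hη : 0 < η)
    (hc : 0 < c) : ∀ᶠ d : ℕ in atTop, (d : ℝ) * q ^ (C - η * d) ≤ c := by
  have hq0 : 0 < q := by linarith
  have h0 : 0 < q ^ (-η) := Real.rpow_pos_of_pos hq0 _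
  have h1 : q ^ (-η) < 1 := Real.rpow_lt_one_of_one_lt_of_neg hq (by linarith)
  have h2 := (tendsto_self_mul_const_pow_of_lt_one h0.le h1).const_mul (q ^ C)
  rw [mul_zero] at h2
  filter_upwards [h2.eventually (ge_mem_nhds hc)] with d hd
  refine le_trans (le_of_eq ?_) hd
  rw [sub_eq_add_neg, Real.rpow_add hq0, ← neg_mul, Real.rpow_mul hq0.le, Real.rpow_natCast]
  ring

theorem eventually_rpow_le {q : ℝ} (hq : 1 < q) (C : ℝ) {η c : ℝ} (hη : 0 < η)
    (hc : 0 < c) : ∀ᶠ d : ℕ in atTop, q ^ (C - η * d) ≤ c := by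
  filter_upwards [eventually_natCast_mul_rpow_le hq C hη hc, eventually_ge_atTop 1] with d hd h1
  have h2 : (1 : ℝ) ≤ d := by exact_mod_cast h1
  have h3 : 0 < q ^ (C - η * d) := Real.rpow_pos_of_pos (by linarith) _
  nlinarith

theorem sub_le_mul_ceil {n : ℕ} (hn : 1 ≤ n) (x : ℝ) : x ≤ n * (⌈x / n⌉₊ : ℝ) := by
  have h1 : (1 : ℝ) ≤ n := by exact_mod_cast hn
  have h := Nat.le_ceil (x / n)
  rwa [div_le_iff₀ (by linarith), mul_comm] at h

theorem mul_ceil_le {n : ℕ} (hn : 1 ≤ n) {x : ℝ} (hx : 0 ≤ x) : n * (⌈x / n⌉₊ : ℝ) ≤ x + n := by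
  have h1 : (1 : ℝ) ≤ n := by exact_mod_cast hn
  have h := (Nat.ceil_lt_add_one (div_nonneg hx (by linarith : (0 : ℝ) ≤ n))).le
  have h2 := mul_le_mul_of_nonneg_left h (by linarith : (0 : ℝ) ≤ n)
  rwa [mul_add, mul_div_cancel₀ _ (by linarith : (n : ℝ) ≠ 0), mul_one] at h2

/-- With `M = ⌈(1+ε)d/n⌉` the product on the left is at most `q^(n - ε d)` times the right-hand
side. -/
theorem eventually_exists_good_bound {q : ℝ} (hq : 2 ≤ q) {n : ℕ} (hn : 1 ≤ n) {ε : ℝ}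
    (hε : 0 < ε) : ∀ᶠ d : ℕ in atTop,
      1 + q ^ (d : ℝ) * q ^ (n * ((d : ℝ) - (⌈(1 + ε) * d / n⌉₊ : ℝ) + 1)) <
        q ^ ((n : ℝ) * d) := by
  have hq1 : 1 < q := by linarith
  have hq0 : 0 < q := by linarith
  have hn1 : (1 : ℝ) ≤ n := by exact_mod_cast hn
  filter_upwards [eventually_rpow_le hq1 n hε (by norm_num : (0 : ℝ) < 1 / 4),
    eventually_rpow_le hq1 0 (by linarith : (0 : ℝ) < n) (by norm_num : (0 : ℝ) < 1 / 4)] with d h1 h2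
  have hT : 0 < q ^ ((n : ℝ) * d) := Real.rpow_pos_of_pos hq0 _
  have h3 : q ^ (d : ℝ) * q ^ (n * ((d : ℝ) - (⌈(1 + ε) * d / n⌉₊ : ℝ) + 1)) ≤
      q ^ ((n : ℝ) * d) * q ^ ((n : ℝ) - ε * d) := by
    rw [← Real.rpow_add hq0, ← Real.rpow_add hq0]
    refine Real.rpow_le_rpow_of_exponent_le hq1.le ?_
    linarith [sub_le_mul_ceil hn ((1 + ε) * d)]
  have h4 : 1 = q ^ ((n : ℝ) * d) * q ^ (0 - (n : ℝ) * d) := by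
    rw [← Real.rpow_add hq0]
    simp
  nlinarith

/-- Each of the four error terms becomes at most an eighth of the right-hand side, and the last
summand is at most half of it because `q ≥ 2`. The order of the quantifiers matters: the last sum is
a geometric tail from `e = a` with an extra factor `q^(ε a)`, small for large `a` because `ε < δ`;
the other terms are small once `d` is large in terms of `a`. -/
theorem eventually_children_bound {q : ℝ} (hq : 2 ≤ q) {n : ℕ} (hn : 1 ≤ n) {s ε : ℝ} (hs : 1 < s)
    (hε : 0 < ε) (hεs : ε < n * (s - 1) - 1) : ∀ᶠ a : ℕ in atTop, ∀ᶠ d : ℕ in atTop,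
      ((1 + q ^ (d : ℝ) * q ^ (n * ((d : ℝ) - (⌈(1 + ε) * d / n⌉₊ : ℝ) + 1))) +
      (∑ e ∈ (Finset.range d).filter (fun e : ℕ => (d : ℝ) < s * e),
        q ^ ((e + 1 : ℕ) : ℝ) * q ^ (n * ((d : ℝ) + (e - s * e) + 1))) +
      (∑ e ∈ (Finset.range d).filter (fun e : ℕ => a ≤ e ∧ s * e ≤ d),
        q ^ (((e + 1 - a : ℕ) : ℝ) + n * ((⌈(1 + ε) * a / n⌉₊ : ℝ) + (e - s * a))) *
          q ^ (n * ((d : ℝ) - s * e + 1)))) + q ^ (n * ((d : ℝ) - ⌈s * a⌉₊) - 1) ≤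
      q ^ (n * ((d : ℝ) - ⌈s * a⌉₊)) := by
  have hq1 : 1 < q := by linarith
  have hq0 : 0 < q := by linarith
  have hn1 : (1 : ℝ) ≤ n := by exact_mod_cast hn
  set δ : ℝ := n * (s - 1) - 1 with hδ
  have hδ0 : 0 < δ := hε.trans hεs
  set θ : ℝ := q ^ (-δ) with hθ
  have hθ0 : 0 < θ := Real.rpow_pos_of_pos hq0 _
  have hθ1 : θ < 1 := Real.rpow_lt_one_of_one_lt_of_neg hq1 (by linarith)
  filter_upwards [eventually_rpow_le hq1 (3 * n + 1) (by linarith : 0 < δ - ε)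
    (by linarith : 0 < (1 - θ) / 8)] with a ha
  set R := ⌈s * (a : ℝ)⌉₊ with hR
  have ha0 : (0 : ℝ) ≤ a := Nat.cast_nonneg a
  have hRle : (R : ℝ) ≤ s * a + 1 := (Nat.ceil_lt_add_one (by positivity)).le
  filter_upwards [eventually_rpow_le hq1 (n * R) (by linarith : (0 : ℝ) < n)
      (by norm_num : (0 : ℝ) < 1 / 8),
    eventually_rpow_le hq1 (n + n * R) hε (by norm_num : (0 : ℝ) < 1 / 8),
    eventually_natCast_mul_rpow_le hq1 (n + 1 + n * R) (div_pos hδ0 (by linarith : 0 < s))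
      (by norm_num : (0 : ℝ) < 1 / 8)] with d h0 h1 h2
  set T := q ^ (n * ((d : ℝ) - R)) with hT
  have hT0 : 0 < T := Real.rpow_pos_of_pos hq0 _
  have t0 : (1 : ℝ) ≤ T * (1 / 8) := by
    refine le_trans (le_of_eq ?_) (mul_le_mul_of_nonneg_left h0 hT0.le)
    rw [hT, ← Real.rpow_add hq0]
    ring_nf
    simp
  have t1 : q ^ (d : ℝ) * q ^ (n * ((d : ℝ) - (⌈(1 + ε) * d / n⌉₊ : ℝ) + 1)) ≤ T * (1 / 8) := by
    refine le_trans ?_ (mul_le_mul_of_nonneg_left h1 hT0.le)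
    rw [hT, ← Real.rpow_add hq0, ← Real.rpow_add hq0]
    refine Real.rpow_le_rpow_of_exponent_le hq1.le ?_
    linarith [sub_le_mul_ceil hn ((1 + ε) * d)]
  have t2 : (∑ e ∈ (Finset.range d).filter (fun e : ℕ => (d : ℝ) < s * e),
        q ^ ((e + 1 : ℕ) : ℝ) * q ^ (n * ((d : ℝ) + (e - s * e) + 1))) ≤ T * (1 / 8) := by
    have hterm : ∀ e ∈ (Finset.range d).filter (fun e : ℕ => (d : ℝ) < s * e),
        q ^ ((e + 1 : ℕ) : ℝ) * q ^ (n * ((d : ℝ) + (e - s * e) + 1)) ≤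
          T * q ^ (n + 1 + n * R - δ / s * d) := by
      intro e he
      have he' := (Finset.mem_filter.1 he).2
      rw [hT, ← Real.rpow_add hq0, ← Real.rpow_add hq0]
      refine Real.rpow_le_rpow_of_exponent_le hq1.le ?_
      have h3 : δ / s * d ≤ δ * e := by
        rw [div_mul_eq_mul_div, div_le_iff₀ (by linarith)]
        nlinarith
      push_cast
      rw [hδ] at h3 ⊢
      linarith
    refine (Finset.sum_le_sum hterm).trans ?_
    rw [Finset.sum_const, nsmul_eq_mul]
    have hcard : ((((Finset.range d).filter (fun e : ℕ => (d : ℝ) < s * e)).card : ℕ) : ℝ) ≤ d := by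
      have := Finset.card_filter_le (Finset.range d) (fun e : ℕ => (d : ℝ) < s * e)
      rw [Finset.card_range] at this
      exact_mod_cast this
    have h3 : 0 < q ^ ((n : ℝ) + 1 + n * R - δ / s * d) := Real.rpow_pos_of_pos hq0 _
    calc _ ≤ (d : ℝ) * (T * q ^ ((n : ℝ) + 1 + n * R - δ / s * d)) :=
          mul_le_mul_of_nonneg_right hcard (by positivity)
      _ = T * (d * q ^ ((n : ℝ) + 1 + n * R - δ / s * d)) := by ring
      _ ≤ _ := mul_le_mul_of_nonneg_left h2 hT0.le
  have t3 : (∑ e ∈ (Finset.range d).filter (fun e : ℕ => a ≤ e ∧ s * e ≤ d),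
        q ^ (((e + 1 - a : ℕ) : ℝ) + n * ((⌈(1 + ε) * a / n⌉₊ : ℝ) + (e - s * a))) *
          q ^ (n * ((d : ℝ) - s * e + 1))) ≤ T * (1 / 8) := by
    have hterm : ∀ e ∈ (Finset.range d).filter (fun e : ℕ => a ≤ e ∧ s * e ≤ d),
        q ^ (((e + 1 - a : ℕ) : ℝ) + n * ((⌈(1 + ε) * a / n⌉₊ : ℝ) + (e - s * a))) *
          q ^ (n * ((d : ℝ) - s * e + 1)) ≤ T * q ^ (3 * n + 1 + ε * a) * θ ^ e := by
      intro e he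
      have he' := (Finset.mem_filter.1 he).2
      rw [hT, hθ, ← Real.rpow_natCast (q ^ (-δ)), ← Real.rpow_mul hq0.le, ← Real.rpow_add hq0,
        ← Real.rpow_add hq0, ← Real.rpow_add hq0]
      refine Real.rpow_le_rpow_of_exponent_le hq1.le ?_
      have h4 := mul_ceil_le hn (x := (1 + ε) * a) (by positivity)
      rw [Nat.cast_sub (by omega), hδ]
      push_cast
      nlinarith
    refine (Finset.sum_le_sum hterm).trans ?_
    have hsub : (Finset.range d).filter (fun e : ℕ => a ≤ e ∧ s * e ≤ d) ⊆ Finset.Ico a d := by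
      intro e he
      obtain ⟨he1, he2, _⟩ := Finset.mem_filter.1 he
      exact Finset.mem_Ico.2 ⟨he2, Finset.mem_range.1 he1⟩
    have hA : 0 < q ^ (3 * (n : ℝ) + 1 + ε * a) := Real.rpow_pos_of_pos hq0 _
    rw [← Finset.mul_sum]
    have hgeom : ∑ e ∈ (Finset.range d).filter (fun e : ℕ => a ≤ e ∧ s * e ≤ d), θ ^ e ≤
        θ ^ a / (1 - θ) :=
      (Finset.sum_le_sum_of_subset_of_nonneg hsub fun e _ _ => (pow_pos hθ0 e).le).trans
        (geom_sum_Ico_le_of_lt_one hθ0.le hθ1)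
    have hfin : q ^ (3 * (n : ℝ) + 1 + ε * a) * θ ^ a ≤ (1 - θ) / 8 := by
      refine le_trans (le_of_eq ?_) ha
      rw [hθ, ← Real.rpow_natCast (q ^ (-δ)), ← Real.rpow_mul hq0.le, ← Real.rpow_add hq0]
      ring_nf
    calc _ ≤ T * q ^ (3 * (n : ℝ) + 1 + ε * a) * (θ ^ a / (1 - θ)) :=
          mul_le_mul_of_nonneg_left hgeom (by positivity)
      _ = T * (q ^ (3 * (n : ℝ) + 1 + ε * a) * θ ^ a / (1 - θ)) := by ring
      _ ≤ _ := by
        refine mul_le_mul_of_nonneg_left ?_ hT0.le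
        rw [div_le_iff₀ (by linarith)]
        linarith
  have t4 : q ^ (n * ((d : ℝ) - R) - 1) ≤ T * (1 / 2) := by
    rw [Real.rpow_sub_one hq0.ne', ← hT, div_eq_mul_one_div]
    refine mul_le_mul_of_nonneg_left ?_ hT0.le
    exact one_div_le_one_div_of_le two_pos hq
  linarith

variable {F : Type*} [Field F] [Finite F]

theorem eventually_rpow_le_ncard_monicIrreducible {ε : ℝ} (hε : 0 < ε) :
    ∀ᶠ d : ℕ in atTop, Q F ^ ((1 - ε) * d) ≤ (monicIrreducible F d).ncard := by
  filter_upwards [eventually_ge_atTop 1,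
    eventually_natCast_mul_rpow_le (one_lt_card (F := F)) 0 hε (by norm_num : (0 : ℝ) < 1 / 2),
    eventually_natCast_mul_rpow_le (one_lt_card (F := F)) 1 (by norm_num : (0 : ℝ) < 1 / 2)
      (by norm_num : (0 : ℝ) < 1 / 2)] with d hd h1 h2
  have h3 := rpow_le_mul_ncard_monicIrreducible (F := F) hd
  have hd0 : (0 : ℝ) < d := by exact_mod_cast hd
  have hT : 0 < Q F ^ (d : ℝ) := Real.rpow_pos_of_pos Q_pos _
  have e1 : (d : ℝ) * Q F ^ ((1 - ε) * d) = Q F ^ (d : ℝ) * (d * Q F ^ (0 - ε * d)) := by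
    rw [mul_left_comm, ← Real.rpow_add Q_pos]
    ring_nf
  have e2 : (d : ℝ) * Q F ^ ((d : ℝ) / 2 + 1) = Q F ^ (d : ℝ) * (d * Q F ^ (1 - 1 / 2 * (d : ℝ))) := by
    rw [mul_left_comm, ← Real.rpow_add Q_pos]
    ring_nf
  have h4 := mul_le_mul_of_nonneg_left h1 hT.le
  have h5 := mul_le_mul_of_nonneg_left h2 hT.le
  rw [← e1] at h4
  rw [← e2] at h5
  have h6 : (d : ℝ) * Q F ^ ((1 - ε) * d) ≤ d * (monicIrreducible F d).ncard := by
    rw [mul_add] at h3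
    linarith
  exact le_of_mul_le_mul_left h6 hd0

/-- Degrees `d` with `⌈s d⌉ - s d` small. -/
theorem frequently_ceil_sub_le {s : ℝ} (hs : 0 < s) {η : ℝ} (hη : 0 < η) :
    ∃ᶠ d : ℕ in atTop, (⌈s * d⌉₊ : ℝ) - s * d ≤ η := by
  have key : ∀ η : ℝ, 0 < η → ∃ d : ℕ, 1 ≤ d ∧ ∃ j : ℤ, 0 ≤ (j : ℝ) - s * d ∧ (j : ℝ) - s * d ≤ η := by
    intro η hη
    obtain ⟨N, hN⟩ := exists_nat_gt (1 / η)
    have hN0 : 0 < N := by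
      have : (0 : ℝ) < N := (by positivity : (0 : ℝ) < 1 / η).trans hN
      exact_mod_cast this
    obtain ⟨j, k, hk0, hkN, hjk⟩ := Real.exists_int_int_abs_mul_sub_le s hN0
    have hsmall : (1 : ℝ) / (N + 1) ≤ η := by
      rw [div_le_iff₀ (by positivity)]
      rw [div_lt_iff₀ hη] at hN
      nlinarith
    lift k to ℕ using hk0.le
    have hk1 : 1 ≤ k := by omega
    have habs := hjk.trans hsmall
    rw [mul_comm] at habs
    push_cast at habs
    rcases le_or_gt 0 ((j : ℝ) - s * k) with h | h
    · refine ⟨k, hk1, j, h, ?_⟩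
      have := (abs_le.1 habs).1
      linarith
    · set τ := s * k - j with hτ
      have hτ0 : 0 < τ := by linarith
      have hτη : τ ≤ η := (abs_le.1 habs).2
      rcases le_or_gt τ 1 with hτ1 | hτ1
      -- Here `s k` exceeds the integer `j` by `τ`. As `m τ` lies in `(1 - τ, 1]`, the multiple `s m
      -- k` falls short of `m j + 1` by less than `τ`.
      · set m := ⌊1 / τ⌋₊ with hm
        have hm1 : 1 ≤ m := Nat.le_floor (by
          rw [Nat.cast_one, le_div_iff₀ hτ0]
          linarith)
        have h1 : (m : ℝ) ≤ 1 / τ := Nat.floor_le (by positivity)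
        have h2 : 1 / τ < m + 1 := Nat.lt_floor_add_one _
        rw [le_div_iff₀ hτ0] at h1
        rw [div_lt_iff₀ hτ0] at h2
        have h3 : (((m * j + 1 : ℤ) : ℝ)) - s * ((m * k : ℕ) : ℝ) = 1 - m * τ := by
          push_cast
          rw [hτ]
          ring
        refine ⟨m * k, Nat.mul_pos hm1 hk1, m * j + 1, ?_, ?_⟩
        · rw [h3]; linarith
        · rw [h3]; linarith
      · refine ⟨1, le_rfl, ⌈s * (1 : ℕ)⌉, ?_, ?_⟩
        · linarith [Int.le_ceil (s * (1 : ℕ))]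
        · linarith [Int.ceil_lt_add_one (s * (1 : ℕ))]
  rw [frequently_atTop]
  intro m
  -- Multiplying by `m + 1` makes the degree exceed `m` and enlarges the gap by the same factor.
  obtain ⟨d, hd, j, hj0, hj⟩ := key (η / (m + 1)) (by positivity)
  refine ⟨(m + 1) * d, by nlinarith, ?_⟩
  have h1 : (⌈s * ((m + 1) * d : ℕ)⌉₊ : ℤ) ≤ (m + 1) * j := by
    rw [Int.natCast_ceil_eq_ceil (by positivity), Int.ceil_le]
    push_cast
    nlinarith
  have h2 : (⌈s * ((m + 1) * d : ℕ)⌉₊ : ℝ) ≤ (m + 1) * j := by exact_mod_cast h1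
  rw [le_div_iff₀ (by positivity)] at hj
  push_cast at h2 ⊢
  nlinarith

end

/-! ### The lower bound -/

section

open Filter Topology

/-- Dependent choice; the relation may vary with `k` so that the tolerance for `⌈s d⌉ - s d` can
shrink along the sequence. -/
theorem exists_seq_of_forall_exists {α : Type*} {B : α → Prop} {S : ℕ → α → α → Prop}
    (h0 : ∃ a, B a) (h : ∀ k a, B a → ∃ b, B b ∧ S k a b) :
    ∃ D : ℕ → α, ∀ k, B (D k) ∧ S k (D k) (D (k + 1)) := by
  obtain ⟨a₀, ha₀⟩ := h0
  choose f hf1 hf2 using h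
  let D : ℕ → {a // B a} := fun k =>
    Nat.rec ⟨a₀, ha₀⟩ (fun k a => ⟨f k a.1 a.2, hf1 k a.1 a.2⟩) k
  exact ⟨fun k => (D k).1, fun k => ⟨(D k).2, hf2 k _ (D k).2⟩⟩

variable {F : Type*} [Field F] [Finite F] {n : ℕ}

theorem pt_smul {u : F[X]} (hu : u ≠ 0) (p : (Fin n → F[X]) × F[X]) : pt (u • p) = pt p := by
  funext i
  simp only [pt, Prod.smul_fst, Prod.smul_snd, Pi.smul_apply, smul_eq_mul, map_mul]
  exact mul_div_mul_left _ _ (ofPoly_ne_zero hu)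

/-- A criterion for exact approximability by a sequence of fractions. -/
theorem mem_exact_of_seq {s : ℝ} (hs : 0 < s) {x : Fin n → Series F} {D : ℕ → ℕ}
    {p : ℕ → (Fin n → F[X]) × F[X]} (hD : StrictMono D)
    (hgap : Tendsto (fun k => (⌈s * D k⌉₊ : ℝ) - s * D k) atTop (𝓝 0))
    (hp0 : ∀ k, (p k).2 ≠ 0) (hpD : ∀ k, (p k).2.natDegree = D k)
    (hroot : ∀ i, ‖pt (p 0) i‖ ≤ 1)
    (hxp : ∀ k, ‖x - pt (p k)‖ = Q F ^ (-(⌈s * D k⌉₊ : ℝ)))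
    (havoid : ∀ k (b : (Fin n → F[X]) × F[X]), b.2 ≠ 0 → D k ≤ b.2.natDegree →
      b.2.natDegree < D (k + 1) → ‖pt b - pt (p (k + 1))‖ ≤ Q F ^ (-(s * b.2.natDegree)) →
      ∃ u : F[X], b = u • p k) :
    x ∈ Exact F n fun r : ℝ => r ^ (-s) := by
  have hceil : ∀ k, Q F ^ (-(⌈s * D k⌉₊ : ℝ)) ≤ Q F ^ (-(s * D k)) := fun k =>
    Real.rpow_le_rpow_of_exponent_le one_lt_card.le (neg_le_neg (Nat.le_ceil _))
  have hx1 : ∀ i, ‖x i‖ ≤ 1 := by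
    intro i
    have h1 : ‖x i - pt (p 0) i‖ ≤ 1 := by
      refine (norm_le_pi_norm (x - pt (p 0)) i).trans ((hxp 0).le.trans ?_)
      exact Real.rpow_le_one_of_one_le_of_nonpos one_lt_card.le (by simp)
    have h2 := dist_triangle_max (x i) (pt (p 0) i) 0
    rw [dist_zero_right, dist_zero_right, dist_eq_norm] at h2
    exact h2.trans (max_le h1 (hroot i))
  have hrpow : ∀ b : (Fin n → F[X]) × F[X], b.2 ≠ 0 →
      ‖ofPoly b.2‖ ^ (-s) = Q F ^ (-(s * b.2.natDegree)) := by
    intro b hb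
    rw [rpow_norm_ofPoly hb, neg_mul]
  refine ⟨⟨hx1, ?_⟩, ?_⟩
  · refine Set.infinite_of_injective_forall_mem (f := p) ?_ fun k => ⟨hp0 k, ?_⟩
    · intro k l hkl
      refine hD.injective ?_
      rw [← hpD k, ← hpD l, hkl]
    · change ‖x - pt (p k)‖ ≤ ‖ofPoly (p k).2‖ ^ (-s)
      rw [hrpow _ (hp0 k), hpD k, hxp k]
      exact hceil k
  · rintro c hc0 hc1 ⟨-, hinf⟩
    -- This is the ratio of `‖x - pt (p k)‖` to `ψ` of the denominator. Once it exceeds `c`, neither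
    -- `p k` nor its multiples can be `cψ`-approximations.
    have hlim : Tendsto (fun k => Q F ^ (-((⌈s * D k⌉₊ : ℝ) - s * D k))) atTop (𝓝 1) := by
      have h1 := (Real.continuous_const_rpow (Q_pos (F := F)).ne').continuousAt.tendsto.comp
        hgap.neg
      simpa only [neg_zero, Real.rpow_zero, Function.comp_def] using h1
    obtain ⟨K, hK⟩ := eventually_atTop.1 (hlim.eventually (lt_mem_nhds hc1))
    obtain ⟨b, ⟨hb0, hb⟩, hbK⟩ := hinf.exists_notMem_finite (finite_setOf_natDegree_lt hx1 (D K))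
    change ‖x - pt b‖ ≤ c * ‖ofPoly b.2‖ ^ (-s) at hb
    have hb1 : ‖x - pt b‖ ≤ ‖ofPoly b.2‖ ^ (-s) :=
      hb.trans (mul_le_of_le_one_left (Real.rpow_nonneg (norm_nonneg _) _) hc1.le)
    have hKb : D K ≤ b.2.natDegree := by
      by_contra! h
      exact hbK ⟨hb0, hb1.trans (rpow_neg_norm_ofPoly_le_one hb0 hs.le), h⟩
    obtain ⟨k, hk1, hk2, hk3⟩ : ∃ k, K ≤ k ∧ D k ≤ b.2.natDegree ∧ b.2.natDegree < D (k + 1) := by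
      have hex : ∃ m, b.2.natDegree < D m := ⟨b.2.natDegree + 1, hD.le_apply⟩
      classical
      have h1 := Nat.find_spec hex
      have h2 : K < Nat.find hex := by
        by_contra! h
        exact absurd (hKb.trans_lt h1) (not_lt.2 (hD.monotone h))
      obtain ⟨k, hk⟩ : ∃ k, Nat.find hex = k + 1 := ⟨Nat.find hex - 1, by omega⟩
      exact ⟨k, by omega, not_lt.1 (Nat.find_min hex (by omega)), hk ▸ h1⟩
    have hnear : ‖pt b - pt (p (k + 1))‖ ≤ Q F ^ (-(s * b.2.natDegree)) := by
      have h1 := dist_triangle_max (pt b) x (pt (p (k + 1)))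
      rw [dist_comm (pt b) x] at h1
      simp only [dist_eq_norm] at h1
      refine h1.trans (max_le (hrpow b hb0 ▸ hb1) ?_)
      rw [hxp]
      refine (hceil (k + 1)).trans (Real.rpow_le_rpow_of_exponent_le one_lt_card.le ?_)
      have : (b.2.natDegree : ℝ) ≤ D (k + 1) := by exact_mod_cast hk3.le
      nlinarith
    obtain ⟨u, hu⟩ := havoid k b hb0 hk2 hk3 hnear
    have hu0 : u ≠ 0 := by
      rintro rfl
      exact hb0 (by rw [hu]; simp)
    rw [hrpow b hb0, show pt b = pt (p k) by rw [hu, pt_smul hu0], hxp k] at hb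
    have h1 : Q F ^ (-(s * b.2.natDegree)) ≤ Q F ^ (-(s * D k)) := by
      refine Real.rpow_le_rpow_of_exponent_le one_lt_card.le ?_
      have : (D k : ℝ) ≤ b.2.natDegree := by exact_mod_cast hk2
      nlinarith
    have h2 := hb.trans (mul_le_mul_of_nonneg_left h1 hc0.le)
    have h3 := hK k hk1
    have h4 : Q F ^ (-((⌈s * D k⌉₊ : ℝ) - s * D k)) * Q F ^ (-(s * D k)) =
        Q F ^ (-(⌈s * D k⌉₊ : ℝ)) := by
      rw [← Real.rpow_add Q_pos]
      ring_nf
    rw [← h4] at h2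
    exact absurd (le_of_mul_le_mul_right h2 (Real.rpow_pos_of_pos Q_pos _)) (not_le.2 h3)

/-- The number of children is large compared to the size of the balls in the next generation. -/
theorem eventually_rpow_le_card_children {n : ℕ} (hn : 1 ≤ n) {s t ε : ℝ} (hs : 0 < s) (ht : 0 ≤ t)
    (hε : 0 < ε) (h1 : 2 * ε < n - t) (h2 : ε < n + 1 - s * t) (a : ℕ) :
    ∀ᶠ d : ℕ in atTop,
      Q F ^ ((n : ℝ) + 1 + t * ⌈s * d⌉₊) ≤
        (monicIrreducible F d).ncard * Q F ^ (n * ((d : ℝ) - ⌈s * a⌉₊) - 1) ∧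
      Q F ^ (1 + n * ((⌈(1 + ε) * d / n⌉₊ : ℝ) + d) - d * (n - t)) ≤
        (monicIrreducible F d).ncard * Q F ^ (n * ((d : ℝ) - ⌈s * a⌉₊) - 1) := by
  filter_upwards [eventually_rpow_le_ncard_monicIrreducible (F := F) hε,
    eventually_le_mul_natCast ((n : ℝ) + 2 + t + n * ⌈s * a⌉₊) (by linarith : 0 < n + 1 - ε - s * t),
    eventually_le_mul_natCast ((n : ℝ) + 2 + n * ⌈s * a⌉₊) (by linarith : 0 < n - t - 2 * ε)]
    with d hI h3 h4
  have hI' := mul_le_mul_of_nonneg_right hI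
    (Real.rpow_pos_of_pos (Q_pos (F := F)) (n * ((d : ℝ) - ⌈s * a⌉₊) - 1)).le
  rw [← Real.rpow_add Q_pos] at hI'
  have hd0 : (0 : ℝ) ≤ d := Nat.cast_nonneg d
  constructor
  · refine le_trans (Real.rpow_le_rpow_of_exponent_le one_lt_card.le ?_) hI'
    have h5 : (⌈s * d⌉₊ : ℝ) ≤ s * d + 1 := (Nat.ceil_lt_add_one (by positivity)).le
    nlinarith
  · refine le_trans (Real.rpow_le_rpow_of_exponent_le one_lt_card.le ?_) hI'
    have h5 := mul_ceil_le hn (x := (1 + ε) * d) (by positivity)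
    nlinarith

theorem le_dimH_exact (hn : 1 ≤ n) {s : ℝ} (hs : 1 + 1 / (n : ℝ) < s) (t : NNReal)
    (ht : s * t < n + 1) : (t : ENNReal) ≤ dimH (Exact F n fun r : ℝ => r ^ (-s)) := by
  have hn1 : (1 : ℝ) ≤ n := by exact_mod_cast hn
  have hδ : 0 < n * (s - 1) - 1 := by
    have h1 : 1 / (n : ℝ) < s - 1 := by linarith
    rw [div_lt_iff₀ (by linarith)] at h1
    linarith
  have hs1 : 1 < s := by
    have : 0 < 1 / (n : ℝ) := by positivity
    linarith
  have ht0 : (0 : ℝ) ≤ t := t.2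
  have htn : (0 : ℝ) < n - t := by
    by_contra! h
    nlinarith
  -- The first upper bound makes children plentiful and separated; the other two make their number
  -- beat the mass required at small radii.
  obtain ⟨ε, hε, hε1, hε2, hε3⟩ : ∃ ε : ℝ, 0 < ε ∧ ε < n * (s - 1) - 1 ∧ 2 * ε < n - t ∧
      ε < n + 1 - s * t := by
    have h3 : 0 < (n : ℝ) + 1 - s * t := by linarith
    obtain ⟨ε, h4, h5⟩ := exists_between
      (lt_min hδ (lt_min (half_pos htn) h3) :
        0 < min (n * (s - 1) - 1) (min ((n - t) / 2) (n + 1 - s * t)))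
    obtain ⟨h6, h7⟩ := lt_min_iff.1 h5
    obtain ⟨h8, h9⟩ := lt_min_iff.1 h7
    exact ⟨ε, h4, h6, by linarith, h9⟩
  let M : ℕ → ℕ := fun d => ⌈(1 + ε) * d / n⌉₊
  let R : ℕ → ℕ := fun d => ⌈s * d⌉₊
  let I : ℕ → ℕ := fun d => (monicIrreducible F d).ncard
  let J : ℕ → ℕ → ℕ := fun a d => Nat.card F ^ (n * (d - R a) - 1)
  have hJ : ∀ a d, R a < d → (J a d : ℝ) = Q F ^ (n * ((d : ℝ) - R a) - 1) := by
    intro a d had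
    have h1 : 1 ≤ n * (d - R a) := Nat.mul_pos hn (by omega)
    simp only [J]
    push_cast
    rw [← Real.rpow_natCast]
    push_cast [Nat.cast_sub h1, Nat.cast_sub had.le]
    rfl
  -- The usable degrees. The third clause separates siblings, the fifth provides a root, and the
  -- last provides children for all good pairs of degree `d` uniformly.
  let B : ℕ → Prop := fun d => 1 ≤ d ∧ 1 ≤ M d ∧ (M d : ℝ) + d ≤ R d ∧ 0 < I d ∧
    (1 + Q F ^ (d : ℝ) * Q F ^ (n * ((d : ℝ) - (M d : ℝ) + 1)) < Q F ^ ((n : ℝ) * d)) ∧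
    ∀ᶠ d' : ℕ in atTop, ∀ g ∈ monicIrreducible F d', ∀ p : (Fin n → F[X]) × F[X],
      Good d (M d) p → (childSet s d p (R d) (M d') g).Finite ∧
        J d d' ≤ (childSet s d p (R d) (M d') g).ncard
  have hB : ∀ᶠ d in atTop, B d := by
    filter_upwards [eventually_ge_atTop 1,
      eventually_le_mul_natCast 1 (by rw [lt_div_iff₀ (by linarith)]; linarith :
        0 < (n * (s - 1) - 1 - ε) / n),
      eventually_rpow_le_ncard_monicIrreducible (F := F) hε,
      eventually_exists_good_bound (Q_two_le (F := F)) hn hε,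
      eventually_children_bound (Q_two_le (F := F)) hn hs1 hε hε1] with d h1 h2 h3 h4 h5
    have hd1 : (1 : ℝ) ≤ d := by exact_mod_cast h1
    have hM1 : 1 ≤ M d := Nat.ceil_pos.2 (by positivity)
    refine ⟨h1, hM1, ?_, ?_, h4, ?_⟩
    · have h6 : (M d : ℝ) ≤ (1 + ε) * d / n + 1 := (Nat.ceil_lt_add_one (by positivity)).le
      have h7 : s * d ≤ R d := Nat.le_ceil _
      have h8 : (n * (s - 1) - 1 - ε) / n * d = s * d - d - (1 + ε) * d / n := by
        field_simp
        ring
      linarith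
    · have h6 : (0 : ℝ) < I d := (Real.rpow_pos_of_pos Q_pos _).trans_le h3
      exact_mod_cast h6
    · filter_upwards [h5, eventually_gt_atTop (R d)] with d' h6 h7 g hg p hp
      obtain ⟨hg1, hg2, rfl⟩ := hg
      refine le_ncard_childSet hn hs1.le hM1 (Nat.le_ceil _) hp hg1 hg2 h7.le ?_
      rw [hJ d _ h7]
      exact h6
  have hstep : ∀ k a : ℕ, B a → ∃ d, B d ∧ (R a < d ∧
      (∀ g ∈ monicIrreducible F d, ∀ p : (Fin n → F[X]) × F[X],
        Good a (M a) p → (childSet s a p (R a) (M d) g).Finite ∧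
          J a d ≤ (childSet s a p (R a) (M d) g).ncard) ∧
      Q F ^ ((n : ℝ) + 1 + t * R d) ≤ I d * J a d ∧
      Q F ^ (1 + n * ((M d : ℝ) + d) - d * (n - t)) ≤ I d * J a d ∧
      (R d : ℝ) - s * d ≤ 1 / ((k : ℝ) + 1)) := by
    intro k a ha
    -- Only the small gap is a frequent condition; all the others hold for every large `d`.
    have hfr := frequently_ceil_sub_le (by linarith : 0 < s)
      (by positivity : (0 : ℝ) < 1 / ((k : ℝ) + 1))
    obtain ⟨d, h1, h2, h3, h4, h5⟩ := (hfr.and_eventually (hB.and (ha.2.2.2.2.2.and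
      ((eventually_rpow_le_card_children (F := F) hn (by linarith : 0 < s) ht0 hε hε2 hε3 a).and
        (eventually_gt_atTop (R a)))))).exists
    refine ⟨d, h2, h5, h3, ?_, ?_, h1⟩
    · rw [hJ a d h5]; exact h4.1
    · rw [hJ a d h5]; exact h4.2
  obtain ⟨D, hD⟩ := exists_seq_of_forall_exists hB.exists hstep
  have hRD : ∀ k, R (D k) < D (k + 1) := fun k => (hD k).2.1
  have hsR : ∀ d : ℕ, s * d ≤ R d := fun d => Nat.le_ceil _
  have hdR : ∀ d : ℕ, d ≤ R d := by
    intro d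
    have h1 := hsR d
    have h2 : (0 : ℝ) ≤ d := Nat.cast_nonneg d
    have h3 : (d : ℝ) ≤ R d := by nlinarith
    exact_mod_cast h3
  have hDmono : StrictMono D := strictMono_nat_of_lt_succ fun k => (hdR _).trans_lt (hRD k)
  have hRmono : StrictMono fun k => R (D k) :=
    strictMono_nat_of_lt_succ fun k => (hRD k).trans_le (hdR _)
  -- Exactly `J` numerators are kept for each denominator, so that the number of children depends on
  -- the level only.
  let N : ℕ → ℕ := fun k => I (D (k + 1)) * J (D k) (D (k + 1))
  have hNpos : ∀ k, 0 < N k := fun k =>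
    Nat.mul_pos (hD (k + 1)).1.2.2.2.1 (pow_pos Nat.card_pos _)
  have hchild : ∀ k (p : (Fin n → F[X]) × F[X]), ∃ c : Fin (N k) → (Fin n → F[X]) × F[X],
      Good (D k) (M (D k)) p → Function.Injective c ∧
        ∀ j, (c j).2 ∈ monicIrreducible F (D (k + 1)) ∧
          (c j).1 ∈ childSet s (D k) p (R (D k)) (M (D (k + 1))) (c j).2 := by
    intro k p
    -- Pairs that are not good get dummy children; no branch from the root meets them.
    by_cases hp : Good (D k) (M (D k)) p
    · obtain ⟨c, hc⟩ := exists_children fun g hg => (hD k).2.2.1 g hg p hp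
      exact ⟨c, fun _ => hc⟩
    · exact ⟨fun _ => p, fun h => absurd h hp⟩
  choose c hc using hchild
  obtain ⟨p₀, hp₀, hroot⟩ : ∃ p₀ : (Fin n → F[X]) × F[X],
      Good (D 0) (M (D 0)) p₀ ∧ ∀ i, ‖pt p₀ i‖ ≤ 1 := by
    obtain ⟨g, hg1, hg2, hg3⟩ := Set.nonempty_of_ncard_ne_zero (hD 0).1.2.2.2.1.ne'
    obtain ⟨f, hf⟩ := exists_good (n := n) hg1 hg2 (M (D 0)) (by
      rw [hg3]; exact (hD 0).1.2.2.2.2.1)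
    rw [hg3] at hf
    exact ⟨(f, g), hf⟩
  have hGood : ∀ k p, Good (D k) (M (D k)) p → ∀ j, Good (D (k + 1)) (M (D (k + 1))) (c k p j) := by
    intro k p hp j
    obtain ⟨⟨_, _, h1⟩, h2⟩ := (hc k p hp).2 j
    have h3 := h2.2.1
    rwa [h1] at h3
  have hdist : ∀ k p, Good (D k) (M (D k)) p → ∀ j,
      ‖pt (c k p j) - pt p‖ = Q F ^ (-(R (D k) : ℝ)) := by
    intro k p hp j
    obtain ⟨⟨h0, _, h1⟩, h2⟩ := (hc k p hp).2 j
    exact norm_pt_sub_of_mem_window hn h0.ne_zero (by rw [h1]; exact (hRD k).le) h2.1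
  have hbranch : ∀ ω k, Good (D k) (M (D k)) (branch c p₀ ω k) := by
    intro ω k
    induction k with
    | zero => exact hp₀
    | succ k ih => exact hGood k _ ih _
  have hlim : ∀ ω : ∀ k, Fin (N k), ∃ x : Fin n → Series F,
      ∀ k, ‖x - pt (branch c p₀ ω k)‖ ≤ Q F ^ (-(R (D k) : ℝ)) := by
    intro ω
    have hz : ∀ k, Q F ^ (-(R (D k) : ℤ)) = Q F ^ (-(R (D k) : ℝ)) := by
      intro k
      rw [← Real.rpow_intCast]
      push_cast
      rfl
    have h1 := exists_limit (F := F) (fun k => pt (branch c p₀ ω k)) (fun k => (R (D k) : ℤ))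
      (fun i j hij => Nat.cast_lt.2 (hRmono hij)) fun k => by
        rw [hz]; exact (hdist k _ (hbranch ω k) (ω k)).le
    simpa only [hz] using h1
  choose Φ hΦ using hlim
  have hrlt : StrictAnti fun k => Q F ^ (-(R (D k) : ℝ)) := fun i j hij =>
    Real.rpow_lt_rpow_of_exponent_lt one_lt_card (neg_lt_neg (Nat.cast_lt.2 (hRmono hij)))
  refine le_dimH_of_tree pt (fun k p => Good (D k) (M (D k)) p) N c p₀
    (fun k => Q F ^ (-(R (D k) : ℝ))) t _ hp₀ hNpos hGood hrlt ?_ ?_ ?_ Φ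
    (fun ω k => by rw [dist_eq_norm]; exact hΦ ω k) ?_
  · have h1 : Tendsto (fun k => -(R (D k) : ℝ)) atTop atBot :=
      tendsto_neg_atTop_atBot.comp (tendsto_natCast_atTop_atTop.comp hRmono.tendsto_atTop)
    exact (tendsto_rpow_atBot_of_base_gt_one (Q F) one_lt_card).comp h1
  · intro k p hp i j hij
    rw [dist_eq_norm] at hij
    refine (hc k p hp).1 ((hGood k p hp j).eq_of_norm_sub_le (hD (k + 1)).1.2.1
      (hGood k p hp i) ?_ hij)
    have := (hD (k + 1)).1.2.2.1
    linarith
  · intro k hk p hp i ρ hρ1 hρ2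
    simp only [dist_eq_norm]
    obtain ⟨l, rfl⟩ : ∃ l, k = l + 1 := ⟨k - 1, by omega⟩
    have hρ0 : 0 < ρ := (Real.rpow_pos_of_pos Q_pos _).trans_le hρ1
    obtain ⟨y, rfl⟩ : ∃ y, ρ = Q F ^ y :=
      ⟨Real.logb (Q F) ρ, (Real.rpow_logb Q_pos (ne_of_gt one_lt_card) hρ0).symm⟩
    have hy1 : -(R (D (l + 1 + 1)) : ℝ) ≤ y := (Real.rpow_le_rpow_left_iff one_lt_card).1 hρ1
    have hy2 : y < -(R (D (l + 1)) : ℝ) := (Real.rpow_lt_rpow_left_iff one_lt_card).1 hρ2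
    have hN1 : ∀ i, (1 : ℝ) ≤ N i := fun i => by exact_mod_cast hNpos i
    have hP : (1 : ℝ) ≤ ∏ i ∈ Finset.range l, (N i : ℝ) :=
      Finset.prod_induction _ (fun z : ℝ => 1 ≤ z) (fun _ _ => one_le_mul_of_one_le_of_one_le)
        le_rfl fun i _ => hN1 i
    rw [Finset.prod_range_succ, Finset.prod_range_succ, ← Real.rpow_mul Q_pos.le]
    set P := ∏ i ∈ Finset.range l, (N i : ℝ)
    have hNcast : ∀ k, (N k : ℝ) = I (D (k + 1)) * J (D k) (D (k + 1)) := fun k => by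
      simp only [N]
      push_cast
      rfl
    have hPl : (N l : ℝ) ≤ P * N l := le_mul_of_one_le_left (Nat.cast_nonneg _) hP
    have hPl1 : (1 : ℝ) ≤ P * N l := (hN1 l).trans hPl
    obtain ⟨_, _, hH1, hH2, _⟩ := (hD (l + 1)).2
    rw [← hNcast] at hH1 hH2
    have hsmall : ∀ z : ℝ, z ≤ Q F ^ (y * t) * N (l + 1) →
        z ≤ Q F ^ (y * t) * (P * N l * N (l + 1)) := by
      intro z hz
      refine hz.trans (mul_le_mul_of_nonneg_left ?_ (Real.rpow_pos_of_pos Q_pos _).le)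
      exact le_mul_of_one_le_left (Nat.cast_nonneg _) hPl1
    -- Above the radius `q^(-d)` the count is paid for by the size of the previous generation, `N
    -- l`; below it `N (l + 1)` alone suffices.
    rcases le_or_gt (-(D (l + 1 + 1) : ℝ)) y with hy | hy
    · refine (card_children_le (hc _ p hp).1 (fun j => ((hc _ p hp).2 j).1) _ hy).trans ?_
      have hH0 := (hD l).2.2.2.1
      rw [← hNcast] at hH0
      have h1 := hH0.trans hPl
      rw [hNcast (l + 1), hJ _ _ (hRD (l + 1))]
      have hI0 : (0 : ℝ) ≤ I (D (l + 1 + 1)) := Nat.cast_nonneg _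
      have h2 : Q F ^ (n * (y + (D (l + 1 + 1) : ℝ) + 1)) ≤ Q F ^ (y * t) *
          (Q F ^ ((n : ℝ) + 1 + t * R (D (l + 1))) *
            Q F ^ (n * ((D (l + 1 + 1) : ℝ) - R (D (l + 1))) - 1)) := by
        rw [← Real.rpow_add Q_pos, ← Real.rpow_add Q_pos]
        refine Real.rpow_le_rpow_of_exponent_le one_lt_card.le ?_
        nlinarith
      calc (I (D (l + 1 + 1)) : ℝ) * Q F ^ (n * (y + (D (l + 1 + 1) : ℝ) + 1))
          ≤ I (D (l + 1 + 1)) * (Q F ^ (y * t) * (P * N l *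
            Q F ^ (n * ((D (l + 1 + 1) : ℝ) - R (D (l + 1))) - 1))) := by
            refine mul_le_mul_of_nonneg_left (h2.trans ?_) hI0
            refine mul_le_mul_of_nonneg_left ?_ (Real.rpow_pos_of_pos Q_pos _).le
            exact mul_le_mul_of_nonneg_right h1 (Real.rpow_pos_of_pos Q_pos _).le
        _ = _ := by ring
    · refine hsmall _ ?_
      rcases card_good_le (hD (l + 1 + 1)).1.2.1 (hc _ p hp).1 (hGood _ p hp) i y with h | h
      · refine h.trans ?_
        refine le_trans ?_ (mul_le_mul_of_nonneg_left hH1 (Real.rpow_pos_of_pos Q_pos _).le)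
        rw [← Real.rpow_add Q_pos]
        refine Real.one_le_rpow one_lt_card.le ?_
        nlinarith
      · refine h.trans ?_
        refine le_trans ?_ (mul_le_mul_of_nonneg_left hH2 (Real.rpow_pos_of_pos Q_pos _).le)
        rw [← Real.rpow_add Q_pos]
        refine Real.rpow_le_rpow_of_exponent_le one_lt_card.le ?_
        nlinarith
  · intro ω
    -- The limit is strictly closer to the next vertex than that vertex is to the present one, so
    -- the distance between the two vertices is inherited.
    have heq : ∀ k, ‖Φ ω - pt (branch c p₀ ω k)‖ = Q F ^ (-(⌈s * D k⌉₊ : ℝ)) := by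
      intro k
      refine le_antisymm (hΦ ω k) ?_
      have h1 := dist_triangle_max (pt (branch c p₀ ω (k + 1))) (Φ ω) (pt (branch c p₀ ω k))
      rw [dist_comm _ (Φ ω)] at h1
      simp only [dist_eq_norm] at h1
      rw [show ‖pt (branch c p₀ ω (k + 1)) - pt (branch c p₀ ω k)‖ = Q F ^ (-(R (D k) : ℝ)) from
        hdist k _ (hbranch ω k) (ω k)] at h1
      rcases le_max_iff.1 h1 with h | h
      · exact absurd (h.trans (hΦ ω (k + 1))) (not_le.2 (hrlt (Nat.lt_succ_self k)))
      · exact h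
    refine mem_exact_of_seq (by linarith) hDmono ?_ (fun k => (hbranch ω k).ne_zero)
      (fun k => (hbranch ω k).natDegree_eq) hroot heq fun k b hb0 hkb hbk hb => ?_
    -- The gap is controlled from `D 1` on; the degree of the root is not chosen by a step.
    · rw [← tendsto_add_atTop_iff_nat 1]
      refine squeeze_zero (fun k => sub_nonneg.2 (Nat.le_ceil _)) (fun k => (hD k).2.2.2.2.2)
        tendsto_one_div_add_atTop_nhds_zero_nat
    · obtain ⟨⟨_, _, h1⟩, h2⟩ := (hc k _ (hbranch ω k)).2 (ω k)
      refine h2.2.2 b hb0 hkb ?_ hb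
      rw [h1]
      exact hbk

end

end FormalSeries

end

theorem mainTheorem2 (F : Type*) [Field F] [Finite F] (n : ℕ) (hn : 1 ≤ n)
    (s : ℝ) (hs : 1 + 1 / (n : ℝ) < s) :
    dimH (FormalSeries.Exact F n (fun r : ℝ => r ^ (-s))) = ENNReal.ofReal (((n : ℝ) + 1) / s) := by
  have hs0 : 0 < s := by
    have : 0 ≤ 1 / (n : ℝ) := by positivity
    linarith
  refine le_antisymm ((dimH_mono fun x hx => hx.1).trans
    (FormalSeries.dimH_approximable_le n s hs0)) ?_
  refine ENNReal.le_of_forall_nnreal_lt fun t ht => FormalSeries.le_dimH_exact hn hs t ?_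
  rw [← ENNReal.ofReal_coe_nnreal, ENNReal.ofReal_lt_ofReal_iff_of_nonneg t.coe_nonneg,
    lt_div_iff₀ hs0] at ht
  linarith
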